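/- Let $K$ be a field, $n\ge 0$, and $S=K[X_1,\ldots,X_n]$ with its $\mathbb{Z}^n$-grading in which $\deg X_i=\varepsilon_i$ is the $i$-th canonical basis vector; for $a\in\mathbb{Z}^n$ put $|a|=a_1+\cdots+a_n$. For a finitely generated $\mathbb{Z}^n$-graded $S$-module $M$ let $$\beta_{i,a}(M)=\dim_K \operatorname{Tor}_i^S(M,K)_a\quad(a\in\mathbb{Z}^n),\qquad \beta_{i,j}(M)=\sum_{a\in\mathbb{Z}^n,\ |a|=j}\beta_{i,a}(M)\quad(j\in\mathbb{Z}).$$ For $M\neq 0$ let $\operatorname{reg}(M)=\max\{j\in\mathbb{Z} : \beta_{i,i+j}(M)\ne 0 \text{ for some } i\in\mathbb{N}\}$ and $d_0(M)=\min(\{j\in\mathbb{Z} : \beta_{0,j}(M)\neq 0\}\cup\{\operatorname{reg}(M)\})$, and let $\beta_i^{lin}(M)=\beta_{i,i+d_0(M)}(M)$ be the Betti numbers of the linear strand of $M$ (for $M=0$ put $\beta_i^{lin}(M)=0$). Let $k\in\mathbb{N}$ and let $M$ be a finitely generated $\mathbb{Z}^n$-graded $S$-module which is (up to $\mathbb{Z}^n$-graded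 isomorphism) the $k$-th syzygy module in a minimal $\mathbb{Z}^n$-graded free resolution $\cdots\to F_1\to F_0\to N\to 0$ of a finitely generated $\mathbb{Z}^n$-graded $S$-module $N$; that is, $M\cong N$ if $k=0$, and $M\cong\operatorname{Im}(F_k\to F_{k-1})$ if $k\ge 1$. If $p\in\mathbb{N}$ and $\beta_p^{lin}(M)\ne 0$, then $$\beta_i^{lin}(M)\ \ge\ \binom{p+k}{i+k}\qquad\text{for } i=0,\ldots,p.$$ -/

import Mathlib

open scoped TensorProduct

noncomputable section

/-- The homogeneous component of degree `a ∈ ℤⁿ` of `S = K[X_1, …, X_n]`, where `X_i` has degree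
the `i`-th canonical basis vector. -/
abbrev polyComp (K : Type*) [Field K] (n : ℕ) (a : Fin n → ℤ) :
    Submodule K (MvPolynomial (Fin n) K) :=
  MvPolynomial.weightedHomogeneousSubmodule K
    (fun i : Fin n => (Pi.single i 1 : Fin n → ℤ)) a

/-- The irrelevant maximal ideal `(X_1, …, X_n)` of `S`. -/
def irrelevant (K : Type*) [Field K] (n : ℕ) : Ideal (MvPolynomial (Fin n) K) :=
  Ideal.span (Set.range MvPolynomial.X)

/-- The family `ℳ` of `K`-subspaces makes the `S`-module `M` a `ℤⁿ`-graded module: `M` is the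
direct sum of the `ℳ a`, and `S_a ℳ_b ⊆ ℳ_{a+b}`. -/
class IsMultigraded {K : Type*} [Field K] {n : ℕ} {M : Type*} [AddCommGroup M] [Module K M]
    [Module (MvPolynomial (Fin n) K) M] (ℳ : (Fin n → ℤ) → Submodule K M) : Prop where
  isInternal : DirectSum.IsInternal ℳ
  smul_mem : ∀ (a b : Fin n → ℤ) (f : MvPolynomial (Fin n) K) (m : M),
    f ∈ polyComp K n a → m ∈ ℳ b → f • m ∈ ℳ (a + b)

/-- The degree `a` component of the `ℤⁿ`-graded free module `⨁_j S(-δ_j)`, whose `j`-th basis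
vector has degree `δ j`. -/
def freeComp (K : Type*) [Field K] {n : ℕ} {ι : Type*} (δ : ι → Fin n → ℤ) (a : Fin n → ℤ) :
    Submodule K (ι →₀ MvPolynomial (Fin n) K) where
  carrier := {f | ∀ j, f j ∈ polyComp K n (a - δ j)}
  add_mem' hf hg j := Submodule.add_mem _ (hf j) (hg j)
  zero_mem' _ := Submodule.zero_mem _
  smul_mem' c _ hf j := Submodule.smul_mem _ c (hf j)

/-- A (not necessarily minimal) `ℤⁿ`-graded free resolution
`⋯ → F_2 → F_1 → F_0 → M → 0` of the `ℤⁿ`-graded `S`-module `(M, ℳ)`, with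
`F_i = ⨁_{j ∈ ι i} S(-deg i j)` and `S`-linear maps preserving the `ℤⁿ`-degree. -/
structure GradedFreeResolution.{w, u, v} {K : Type u} [Field K] {n : ℕ} {M : Type v}
    [AddCommGroup M] [Module K M] [Module (MvPolynomial (Fin n) K) M]
    (ℳ : (Fin n → ℤ) → Submodule K M) where
  ι : ℕ → Type w
  deg : ∀ i, ι i → Fin n → ℤ
  /-- The differential `F_{i+1} → F_i`. -/
  d : ∀ i, (ι (i + 1) →₀ MvPolynomial (Fin n) K) →ₗ[MvPolynomial (Fin n) K]
    (ι i →₀ MvPolynomial (Fin n) K)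
  /-- The augmentation `F_0 → M`. -/
  aug : (ι 0 →₀ MvPolynomial (Fin n) K) →ₗ[MvPolynomial (Fin n) K] M
  d_mem : ∀ i a f, f ∈ freeComp K (deg (i + 1)) a → d i f ∈ freeComp K (deg i) a
  aug_mem : ∀ a f, f ∈ freeComp K (deg 0) a → aug f ∈ ℳ a
  aug_surjective : Function.Surjective aug
  exact_zero : Function.Exact (d 0) aug
  exact_succ : ∀ i, Function.Exact (d (i + 1)) (d i)

namespace GradedFreeResolution

variable {K : Type*} [Field K] {n : ℕ} {N : Type*} [AddCommGroup N] [Module K N]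
  [Module (MvPolynomial (Fin n) K) N] {𝒩 : (Fin n → ℤ) → Submodule K N}

/-- The resolution is minimal: `d(F_{i+1}) ⊆ (X_1, …, X_n) F_i` for all `i`. -/
def IsMinimal (F : GradedFreeResolution 𝒩) : Prop :=
  ∀ i, LinearMap.range (F.d i) ≤
    irrelevant K n • (⊤ : Submodule (MvPolynomial (Fin n) K) (F.ι i →₀ MvPolynomial (Fin n) K))

/-- `(M, ℳ)` is, up to an isomorphism of `ℤⁿ`-graded `S`-modules, the `k`-th syzygy module in the
resolution `F` of `N`: for `k = 0` this is `N` itself, and for `k ≥ 1` it is the image of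
`F_k → F_{k-1}` (which is the kernel of the next map), graded as a submodule of `F_{k-1}`. -/
def IsSyzygy (F : GradedFreeResolution 𝒩) {M : Type*} [AddCommGroup M] [Module K M]
    [Module (MvPolynomial (Fin n) K) M] (ℳ : (Fin n → ℤ) → Submodule K M) : ℕ → Prop
  | 0 => ∃ e : M ≃ₗ[MvPolynomial (Fin n) K] N, ∀ a m, m ∈ ℳ a ↔ e m ∈ 𝒩 a
  | k + 1 => ∃ e : M ≃ₗ[MvPolynomial (Fin n) K] LinearMap.range (F.d k),
      ∀ a m, m ∈ ℳ a ↔ (e m : F.ι k →₀ MvPolynomial (Fin n) K) ∈ freeComp K (F.deg k) a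

/-- The term `K ⊗_S F_i` of the complex `K ⊗_S F`, where `K = S / (X_1, …, X_n)`. -/
def Fiber (F : GradedFreeResolution 𝒩) (i : ℕ) : Type _ :=
  (MvPolynomial (Fin n) K ⧸ irrelevant K n) ⊗[MvPolynomial (Fin n) K]
    (F.ι i →₀ MvPolynomial (Fin n) K)

instance (F : GradedFreeResolution 𝒩) (i : ℕ) : AddCommGroup (F.Fiber i) :=
  inferInstanceAs (AddCommGroup ((MvPolynomial (Fin n) K ⧸ irrelevant K n)
    ⊗[MvPolynomial (Fin n) K] (F.ι i →₀ MvPolynomial (Fin n) K)))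

instance (F : GradedFreeResolution 𝒩) (i : ℕ) : Module K (F.Fiber i) :=
  inferInstanceAs (Module K ((MvPolynomial (Fin n) K ⧸ irrelevant K n)
    ⊗[MvPolynomial (Fin n) K] (F.ι i →₀ MvPolynomial (Fin n) K)))

/-- The degree `a` component of `K ⊗_S F_i`: all `1 ⊗ f` with `f` in the degree `a` component of
`F_i`. -/
def fiberComp (F : GradedFreeResolution 𝒩) (i : ℕ) (a : Fin n → ℤ) : Submodule K (F.Fiber i) :=
  (freeComp K (F.deg i) a).map
    ((TensorProduct.mk (MvPolynomial (Fin n) K) (MvPolynomial (Fin n) K ⧸ irrelevant K n)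
      (F.ι i →₀ MvPolynomial (Fin n) K) 1).restrictScalars K)

/-- The differential `K ⊗_S F_{i+1} → K ⊗_S F_i`. -/
def fiberD (F : GradedFreeResolution 𝒩) (i : ℕ) : F.Fiber (i + 1) →ₗ[K] F.Fiber i :=
  ((F.d i).lTensor (MvPolynomial (Fin n) K ⧸ irrelevant K n)).restrictScalars K

/-- The `i`-cycles of degree `a` of `K ⊗_S F`. -/
def cycles (F : GradedFreeResolution 𝒩) : (i : ℕ) → (a : Fin n → ℤ) → Submodule K (F.Fiber i)
  | 0, a => F.fiberComp 0 a
  | i + 1, a => F.fiberComp (i + 1) a ⊓ LinearMap.ker (F.fiberD i)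

/-- The `i`-boundaries of degree `a` of `K ⊗_S F`. -/
def boundaries (F : GradedFreeResolution 𝒩) (i : ℕ) (a : Fin n → ℤ) : Submodule K (F.Fiber i) :=
  (F.fiberComp (i + 1) a).map (F.fiberD i)

/-- The `K`-vector space `Tor_i^S(N, K)_a`, computed as `H_i(K ⊗_S F)_a`. -/
abbrev Tor (F : GradedFreeResolution 𝒩) (i : ℕ) (a : Fin n → ℤ) : Type _ :=
  F.cycles i a ⧸ (F.boundaries i a).submoduleOf (F.cycles i a)

end GradedFreeResolution

/-! The standard graded free resolution: in each step take one basis vector for every homogeneous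
element of the module to be covered. -/

section Standard

lemma single_mem_freeComp {K : Type*} [Field K] {n : ℕ} {ι : Type*} (δ : ι → Fin n → ℤ)
    {b : Fin n → ℤ} (j : ι) {g : MvPolynomial (Fin n) K} (hg : g ∈ polyComp K n b) :
    Finsupp.single j g ∈ freeComp K δ (b + δ j) := by
  intro l
  by_cases h : j = l
  · subst h; simpa using hg
  · rw [Finsupp.single_eq_of_ne (Ne.symm h)]; exact Submodule.zero_mem _

instance freeComp_isMultigraded {K : Type*} [Field K] {n : ℕ} {ι : Type*}
    (δ : ι → Fin n → ℤ) : IsMultigraded (freeComp K δ) where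
  isInternal := by
    classical
    rw [DirectSum.isInternal_submodule_iff_iSupIndep_and_iSup_eq_top]
    constructor
    · rw [iSupIndep_iff_finsetSum_eq_zero_imp_eq_zero]
      intro s v hv hsum a ha
      ext1 j
      let w := fun i : Fin n => (Pi.single i 1 : Fin n → ℤ)
      have h1 := congrArg (MvPolynomial.weightedHomogeneousComponent w (a - δ j))
        (DFunLike.congr_fun hsum j)
      rw [Finsupp.finsetSum_apply, map_sum, Finset.sum_eq_single a] at h1
      · have h2 : MvPolynomial.weightedHomogeneousComponent w (a - δ j) (v a j) = v a j :=
          MvPolynomial.IsWeightedHomogeneous.weightedHomogeneousComponent_same (hv a ha j)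
        rw [h2] at h1
        simpa using h1
      · intro b hb hba
        exact MvPolynomial.IsWeightedHomogeneous.weightedHomogeneousComponent_ne (m := b - δ j) _
          (hv b hb j) (fun h => hba (sub_left_inj.1 h).symm)
      · intro h; exact absurd ha h
    · rw [eq_top_iff]
      rintro f -
      induction f using Finsupp.induction_linear with
      | zero => exact Submodule.zero_mem _
      | add f g hf hg => exact Submodule.add_mem _ hf hg
      | single j g =>
        induction g using MvPolynomial.induction_on' with
        | monomial u c =>
          exact Submodule.mem_iSup_of_mem _ (single_mem_freeComp δ j
            (MvPolynomial.isWeightedHomogeneous_monomial _ u c rfl))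
        | add p q hp hq => rw [Finsupp.single_add]; exact Submodule.add_mem _ hp hq
  smul_mem a b f m hf hm j := by
    have h := MvPolynomial.IsWeightedHomogeneous.mul hf (hm j)
    rw [← add_sub_assoc] at h
    exact h

lemma linearCombination_mem {K : Type*} [Field K] {n : ℕ} {P : Type*} [AddCommGroup P]
    [Module K P] [Module (MvPolynomial (Fin n) K) P] (𝒜 : (Fin n → ℤ) → Submodule K P)
    [IsMultigraded 𝒜] {ι : Type*} (δ : ι → Fin n → ℤ) (v : ι → P) (hv : ∀ j, v j ∈ 𝒜 (δ j))
    (a : Fin n → ℤ) (f : ι →₀ MvPolynomial (Fin n) K) (hf : f ∈ freeComp K δ a) :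
    Finsupp.linearCombination (MvPolynomial (Fin n) K) v f ∈ 𝒜 a := by
  rw [Finsupp.linearCombination_apply]
  refine Submodule.sum_mem _ fun j _ => ?_
  have h := IsMultigraded.smul_mem (ℳ := 𝒜) _ _ (f j) (v j) (hf j) (hv j)
  rwa [sub_add_cancel] at h

lemma exists_sum_homogeneous {K : Type*} [Field K] {n : ℕ} {P : Type*} [AddCommGroup P]
    [Module K P] [Module (MvPolynomial (Fin n) K) P] (𝒜 : (Fin n → ℤ) → Submodule K P)
    [IsMultigraded 𝒜] (x : P) :
    ∃ (s : Finset (Fin n → ℤ)) (v : (Fin n → ℤ) → P), (∀ a, v a ∈ 𝒜 a) ∧ ∑ a ∈ s, v a = x := by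
  classical
  let _ := (IsMultigraded.isInternal (ℳ := 𝒜)).chooseDecomposition
  exact ⟨_, fun a => DirectSum.decompose 𝒜 x a, fun a => Subtype.property _,
    DirectSum.sum_support_decompose 𝒜 x⟩

/-- The kernel of a degree preserving map is generated by homogeneous elements. -/
lemma mem_span_homogeneous_of_mem_ker {K : Type*} [Field K] {n : ℕ} {ι : Type*}
    (δ : ι → Fin n → ℤ) {Q : Type*} [AddCommGroup Q] [Module K Q] [Module (MvPolynomial (Fin n) K) Q]
    (ℬ : (Fin n → ℤ) → Submodule K Q) [IsMultigraded ℬ]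
    (φ : (ι →₀ MvPolynomial (Fin n) K) →ₗ[MvPolynomial (Fin n) K] Q) (hφ : ∀ a x, x ∈ freeComp K δ a → φ x ∈ ℬ a)
    (x : ι →₀ MvPolynomial (Fin n) K) (hx : x ∈ LinearMap.ker φ) :
    x ∈ Submodule.span (MvPolynomial (Fin n) K) {y | ∃ a, y ∈ freeComp K δ a ∧ y ∈ LinearMap.ker φ} := by
  classical
  obtain ⟨s, v, hv, rfl⟩ := exists_sum_homogeneous (freeComp K δ) x
  have hind := (DirectSum.isInternal_submodule_iff_iSupIndep_and_iSup_eq_top _).1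
    (IsMultigraded.isInternal (ℳ := ℬ)) |>.1
  rw [iSupIndep_iff_finsetSum_eq_zero_imp_eq_zero] at hind
  rw [LinearMap.mem_ker, map_sum] at hx
  have h := hind s (fun a => φ (v a)) (fun a _ => hφ a _ (hv a)) hx
  exact Submodule.sum_mem _ fun a ha => Submodule.subset_span ⟨a, hv a, h a ha⟩

/-- A graded free module `⨁_j S(-δ_j)` together with a submodule of it. -/
structure ResolutionStage.{w, u} (K : Type u) [Field K] (n : ℕ) where
  ι : Type (max u w)
  δ : ι → Fin n → ℤ
  Z : Submodule (MvPolynomial (Fin n) K) (ι →₀ MvPolynomial (Fin n) K)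

namespace ResolutionStage

universe u v

variable {K : Type u} [Field K] {n : ℕ}

/-- The indices of the free module covering `Z`: all homogeneous elements of `Z`. -/
abbrev Index (s : ResolutionStage.{v} K n) : Type (max u v) :=
  Σ a : Fin n → ℤ, {x : s.ι →₀ MvPolynomial (Fin n) K // x ∈ freeComp K s.δ a ∧ x ∈ s.Z}

/-- The map from the free module on `Index` onto `Z`. -/
def cover (s : ResolutionStage.{v} K n) :
    (s.Index →₀ MvPolynomial (Fin n) K) →ₗ[MvPolynomial (Fin n) K]
      (s.ι →₀ MvPolynomial (Fin n) K) :=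
  Finsupp.linearCombination (MvPolynomial (Fin n) K) fun j => (j.2 : s.ι →₀ MvPolynomial (Fin n) K)

/-- The next stage: the free module covering `Z`, with the kernel of the covering map. -/
def next (s : ResolutionStage.{v} K n) : ResolutionStage.{v} K n :=
  ⟨s.Index, Sigma.fst, LinearMap.ker s.cover⟩

lemma cover_mem (s : ResolutionStage.{v} K n) (a : Fin n → ℤ)
    (f : s.Index →₀ MvPolynomial (Fin n) K) (hf : f ∈ freeComp K s.next.δ a) :
    s.cover f ∈ freeComp K s.δ a :=
  linearCombination_mem (freeComp K s.δ) _ _ (fun j => j.2.2.1) a f hf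

lemma range_cover (s : ResolutionStage.{v} K n)
    (hs : ∀ x ∈ s.Z, x ∈ Submodule.span (MvPolynomial (Fin n) K)
      {y | ∃ a, y ∈ freeComp K s.δ a ∧ y ∈ s.Z}) :
    LinearMap.range s.cover = s.Z := by
  rw [cover, Finsupp.range_linearCombination]
  apply le_antisymm
  · rw [Submodule.span_le]
    rintro _ ⟨j, rfl⟩
    exact j.2.2.2
  · refine fun x hx => Submodule.span_mono ?_ (hs x hx)
    rintro y ⟨a, hy⟩
    exact ⟨⟨a, y, hy⟩, rfl⟩

lemma exact_next (s : ResolutionStage.{v} K n)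
    (hs : LinearMap.range s.next.cover = s.next.Z) : Function.Exact s.next.cover s.cover :=
  (LinearMap.exact_iff (f := s.next.cover) (g := s.cover)).2 hs.symm

variable {M : Type v} [AddCommGroup M] [Module K M] [Module (MvPolynomial (Fin n) K) M]

/-- The map onto `M` from the free module on all homogeneous elements of `M`. -/
def initAug (ℳ : (Fin n → ℤ) → Submodule K M) :
    (ULift.{max u v} (Σ a : Fin n → ℤ, ℳ a) →₀ MvPolynomial (Fin n) K)
      →ₗ[MvPolynomial (Fin n) K] M :=
  Finsupp.linearCombination (MvPolynomial (Fin n) K) fun j => (j.down.2 : M)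

/-- The stages of the standard resolution of `(M, ℳ)`. -/
def stage (ℳ : (Fin n → ℤ) → Submodule K M) (i : ℕ) : ResolutionStage.{v} K n :=
  Nat.rec ⟨ULift.{max u v} (Σ a : Fin n → ℤ, ℳ a), fun j => j.down.1,
    LinearMap.ker (initAug ℳ)⟩ (fun _ s => s.next) i

lemma initAug_mem (ℳ : (Fin n → ℤ) → Submodule K M) [IsMultigraded ℳ] (a : Fin n → ℤ)
    (f : (stage ℳ 0).ι →₀ MvPolynomial (Fin n) K) (hf : f ∈ freeComp K (stage ℳ 0).δ a) :
    initAug ℳ f ∈ ℳ a :=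
  linearCombination_mem ℳ _ _ (fun j => j.down.2.2) a f hf

lemma exact_init (ℳ : (Fin n → ℤ) → Submodule K M)
    (hs : LinearMap.range (stage ℳ 0).cover = (stage ℳ 0).Z) :
    Function.Exact (stage ℳ 0).cover (initAug ℳ) := by
  intro y
  exact (SetLike.ext_iff.1 hs y).symm

lemma initAug_surjective (ℳ : (Fin n → ℤ) → Submodule K M) [IsMultigraded ℳ] :
    Function.Surjective (initAug ℳ) := by
  intro x
  obtain ⟨s, v, hv, rfl⟩ := exists_sum_homogeneous ℳ x
  rw [← LinearMap.mem_range, initAug, Finsupp.range_linearCombination]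
  exact Submodule.sum_mem _ fun a _ => Submodule.subset_span ⟨⟨⟨a, v a, hv a⟩⟩, rfl⟩

lemma stage_range (ℳ : (Fin n → ℤ) → Submodule K M) [IsMultigraded ℳ] (i : ℕ) :
    LinearMap.range (stage ℳ i).cover = (stage ℳ i).Z := by
  apply range_cover
  cases i with
  | zero =>
    exact mem_span_homogeneous_of_mem_ker (stage ℳ 0).δ ℳ (initAug ℳ)
      (initAug_mem ℳ)
  | succ i =>
    exact mem_span_homogeneous_of_mem_ker (stage ℳ i).next.δ
      (freeComp K (stage ℳ i).δ) (stage ℳ i).cover (stage ℳ i).cover_mem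

end ResolutionStage

open ResolutionStage in
/-- The standard `ℤⁿ`-graded free resolution of a `ℤⁿ`-graded `S`-module. -/
def standardResolution.{u, v} {K : Type u} [Field K] {n : ℕ} {M : Type v} [AddCommGroup M]
    [Module K M] [Module (MvPolynomial (Fin n) K) M] (ℳ : (Fin n → ℤ) → Submodule K M)
    [IsMultigraded ℳ] : GradedFreeResolution.{max u v} ℳ where
  ι i := (stage ℳ i).ι
  deg i := (stage ℳ i).δ
  d i := (stage ℳ i).cover
  aug := initAug ℳ
  d_mem i := (stage ℳ i).cover_mem
  aug_mem := initAug_mem ℳ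
  aug_surjective := initAug_surjective ℳ
  exact_zero := exact_init ℳ (stage_range ℳ 0)
  exact_succ i := (stage ℳ i).exact_next (stage_range ℳ (i + 1))

end Standard

section Betti

variable {K : Type*} [Field K] {n : ℕ} {M : Type*} [AddCommGroup M] [Module K M]
  [Module (MvPolynomial (Fin n) K) M] (ℳ : (Fin n → ℤ) → Submodule K M) [IsMultigraded ℳ]

/-- The `ℤⁿ`-graded Betti number `β_{i,a}(M) = dim_K Tor_i^S(M, K)_a`. -/
def multiBetti (i : ℕ) (a : Fin n → ℤ) : Cardinal :=
  Module.rank K ((standardResolution ℳ).Tor i a)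

/-- The `ℤ`-graded Betti number `β_{i,j}(M) = ∑_{|a| = j} β_{i,a}(M)`. -/
def gradedBetti (i : ℕ) (j : ℤ) : Cardinal :=
  Cardinal.sum fun a : {a : Fin n → ℤ // ∑ l, a l = j} => multiBetti ℳ i a

/-- `r` is the Castelnuovo-Mumford regularity
`reg(M) = max {j : β_{i,i+j}(M) ≠ 0 for some i}`. -/
def IsRegularity (r : ℤ) : Prop :=
  IsGreatest {j : ℤ | ∃ i : ℕ, gradedBetti ℳ i (i + j) ≠ 0} r

/-- `d_k(M) = min ({j : β_{k,k+j}(M) ≠ 0} ∪ {reg(M)})`. -/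
def linDegree (k : ℕ) : ℤ :=
  sInf ({j : ℤ | gradedBetti ℳ k (k + j) ≠ 0} ∪ {r | IsRegularity ℳ r})

/-- `β_i^{k,lin}(M) = β_{i,i+d_k(M)}(M)`. -/
def linBettiFrom (k i : ℕ) : Cardinal :=
  gradedBetti ℳ i (i + linDegree ℳ k)

/-- The Betti numbers `β_i^{lin}(M) = β_i^{0,lin}(M)` of the linear strand of `M`. -/
def linBetti (i : ℕ) : Cardinal :=
  linBettiFrom ℳ 0 i

end Betti

end

/-! Nonvanishing of Tor can be read off the Koszul complex of `M`, which is much easier to control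
than a resolution. Let `d` be the lowest total degree in which `M` is nonzero; it is the degree of
the linear strand. In homological degree `i` and total degree `i + d` a Koszul chain one step higher
would need coefficients in total degree `d - 1`, so there are no nonzero boundaries, and every
nonzero cycle is a nonzero homology class (`hasHomology_top_iff`).

Take a nonzero cycle `z` of degree `p` in this bottom row. Contraction with a dual basis vector
anticommutes with the differential. Hence for each set `J` of `p - i` elements contained in some `L`
with `z L ≠ 0`, contracting along `J` gives a nonzero cycle of degree `i`
(`IsHomogeneous.exists_cycle_of_subset`). Different `J` give different multidegrees, so the linear
Betti number is at least the number of such faces `J`.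

The faces are counted by induction (`choose_le_card_supportFaces`). If `z` involved fewer than `p +
k` variables, vanishing of Koszul homology over those variables would make it a boundary, hence
zero. So at least `p + k` contractions are nonzero; double counting pairs (vertex, face) then gives
the binomial coefficient.

The vanishing is where syzygies enter: Koszul homology over `D` is zero above degree `D.card`, and
since free modules are acyclic, each passage to a kernel improves this bound by one
(`homologyVanishes_ker`). -/

set_option linter.unusedSectionVars false

noncomputable section

/-! ### Contraction, exterior multiplication and the Koszul differential. -/

namespace Koszul

variable {K : Type*} [Field K] {n : ℕ}
  {P : Type*} [AddCommGroup P] [Module (MvPolynomial (Fin n) K) P]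
  {Q : Type*} [AddCommGroup Q] [Module (MvPolynomial (Fin n) K) Q]

/-- The sign of `e_j ∧ e_L` for `j ∉ L`; it does not depend on whether `j ∈ L`. -/
def sign (j : Fin n) (L : Finset (Fin n)) : ℤ := (-1) ^ (L.filter (· < j)).card

lemma sign_mul_self (j : Fin n) (L : Finset (Fin n)) : sign j L * sign j L = 1 := by
  rw [sign, ← pow_add, ← two_mul, pow_mul]; simp

lemma sign_insert (j l : Fin n) (L : Finset (Fin n)) (hl : l ∉ L) :
    sign j (insert l L) = if l < j then - sign j L else sign j L := by
  unfold sign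
  split_ifs with h
  · rw [Finset.filter_insert, if_pos h, Finset.card_insert_of_notMem (by simp [hl]), pow_succ]
    simp
  · rw [Finset.filter_insert, if_neg h]

lemma sign_insert_self (j : Fin n) (L : Finset (Fin n)) : sign j (insert j L) = sign j L := by
  unfold sign
  rw [Finset.filter_insert, if_neg (lt_irrefl j)]

/-- Of two distinct indices exactly one precedes the other, so exactly one of the two signs flips.
-/
lemma sign_insert_mul (j l : Fin n) (hjl : j ≠ l) (L : Finset (Fin n)) (hj : j ∉ L) (hl : l ∉ L) :
    sign j L * sign l (insert j L) = - (sign l L * sign j (insert l L)) := by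
  rw [sign_insert _ _ _ hj, sign_insert _ _ _ hl]
  rcases lt_or_gt_of_ne hjl with h | h
  · simp [h, not_lt.2 h.le]; ring
  · simp [h, not_lt.2 h.le]; ring

variable (K) in
/-- Contraction of Koszul chains with the `j`-th dual basis vector. -/
def contr (j : Fin n) :
    (Finset (Fin n) → P) →ₗ[MvPolynomial (Fin n) K] (Finset (Fin n) → P) where
  toFun c L := if j ∈ L then 0 else sign j L • c (insert j L)
  map_add' c c' := by ext L; by_cases h : j ∈ L <;> simp [h]
  map_smul' r c := by
    ext L; by_cases h : j ∈ L <;> simp [h, smul_comm r]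

variable (K) in
/-- Left multiplication of Koszul chains by the basis vector `e_j`. -/
def wedge (j : Fin n) :
    (Finset (Fin n) → P) →ₗ[MvPolynomial (Fin n) K] (Finset (Fin n) → P) where
  toFun c L := if j ∈ L then sign j L • c (L.erase j) else 0
  map_add' c c' := by ext L; by_cases h : j ∈ L <;> simp [h]
  map_smul' r c := by
    ext L; by_cases h : j ∈ L <;> simp [h, smul_comm r]

lemma contr_apply (j : Fin n) (c : Finset (Fin n) → P) (L : Finset (Fin n)) :
    contr K j c L = if j ∈ L then 0 else sign j L • c (insert j L) := rfl

lemma wedge_apply (j : Fin n) (c : Finset (Fin n) → P) (L : Finset (Fin n)) :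
    wedge K j c L = if j ∈ L then sign j L • c (L.erase j) else 0 := rfl

lemma contr_contr_self (j : Fin n) (c : Finset (Fin n) → P) :
    contr K j (contr K j c) = 0 := by
  ext L; by_cases h : j ∈ L <;> simp [contr_apply, h]

lemma contr_contr (j l : Fin n) (c : Finset (Fin n) → P) :
    contr K j (contr K l c) = - contr K l (contr K j c) := by
  by_cases hjl : j = l
  · subst hjl; simp [contr_contr_self]
  ext L
  by_cases hj : j ∈ L
  · simp [contr_apply, hj]
  by_cases hl : l ∈ L
  · simp [contr_apply, hl]
  simp only [contr_apply, hj, hl, if_false, Finset.mem_insert, hjl, Ne.symm hjl, or_self,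
    Pi.neg_apply, smul_smul]
  rw [sign_insert_mul j l hjl L hj hl, neg_smul, Finset.insert_comm]

/-- With `contr_wedge`, these are the Clifford relations that make `wedge` a contracting homotopy.
-/
lemma contr_wedge_self (j : Fin n) (c : Finset (Fin n) → P) :
    contr K j (wedge K j c) + wedge K j (contr K j c) = c := by
  ext L
  by_cases hj : j ∈ L
  · simp [contr_apply, wedge_apply, hj, smul_smul]
    rw [← sign_insert_self j (L.erase j), Finset.insert_erase hj, sign_mul_self, one_smul]
  · simp [contr_apply, wedge_apply, hj, smul_smul, sign_insert_self, sign_mul_self]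

lemma contr_wedge (j l : Fin n) (hjl : j ≠ l) (c : Finset (Fin n) → P) :
    contr K j (wedge K l c) = - wedge K l (contr K j c) := by
  ext L
  by_cases hj : j ∈ L
  · simp [contr_apply, wedge_apply, hj, hjl]
  by_cases hl : l ∈ L
  · obtain ⟨L, hl', rfl⟩ : ∃ L', l ∉ L' ∧ L = insert l L' :=
      ⟨L.erase l, by simp, (Finset.insert_erase hl).symm⟩
    have hj' : j ∉ L := fun h => hj (by simp [h])
    have e : (insert j (insert l L)).erase l = insert j L := by
      rw [Finset.insert_comm, Finset.erase_insert]; simp [hl', Ne.symm hjl]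
    simp only [contr_apply, wedge_apply, hj, hl, if_false, if_true, Finset.mem_insert, hj',
      or_true, Pi.neg_apply, smul_smul, e, Finset.erase_insert hl']
    rw [Finset.insert_comm, sign_insert_self, sign_insert_self, sign_insert _ _ _ hl',
      sign_insert _ _ _ hj', ← neg_smul]
    congr 1
    rcases lt_or_gt_of_ne hjl with h | h
    · simp [h, not_lt.2 h.le]; ring
    · simp [h, not_lt.2 h.le]; ring
  · simp [contr_apply, wedge_apply, hj, hl, Ne.symm hjl]

variable (K) in
/-- The Koszul differential. -/
def diff : (Finset (Fin n) → P) →ₗ[MvPolynomial (Fin n) K] (Finset (Fin n) → P) :=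
  ∑ j, (MvPolynomial.X j : MvPolynomial (Fin n) K) • contr K j

lemma diff_eq (c : Finset (Fin n) → P) :
    diff K c = ∑ j, (MvPolynomial.X j : MvPolynomial (Fin n) K) • contr K j c := by
  simp [diff]

lemma diff_apply (c : Finset (Fin n) → P) (L : Finset (Fin n)) :
    diff K c L = ∑ j, (MvPolynomial.X j : MvPolynomial (Fin n) K) • contr K j c L := by
  simp [diff]

/-- This is what turns cycles into cycles under contraction. -/
lemma contr_diff (j : Fin n) (c : Finset (Fin n) → P) :
    contr K j (diff K c) = - diff K (contr K j c) := by
  simp only [diff_eq, map_sum, map_smul, ← Finset.sum_neg_distrib, ← smul_neg]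
  exact Finset.sum_congr rfl fun l _ => by rw [contr_contr]

lemma diff_diff (c : Finset (Fin n) → P) : diff K (diff K c) = 0 := by
  have hpair : ∑ p : Fin n × Fin n, ((MvPolynomial.X p.1 * MvPolynomial.X p.2 :
      MvPolynomial (Fin n) K)) • contr K p.1 (contr K p.2 c) = 0 := by
    -- The terms for `(j, l)` and `(l, j)` cancel; the diagonal ones vanish individually, so
    -- characteristic 2 needs no separate treatment.
    refine Finset.sum_ninvolution Prod.swap (fun p => ?_) (fun p hp h => ?_) (by simp) (by simp)
    · rw [Prod.fst_swap, Prod.snd_swap, contr_contr p.2 p.1, mul_comm (MvPolynomial.X p.2)]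
      simp
    · apply hp
      have : p.1 = p.2 := (congrArg Prod.snd h)
      rw [this, contr_contr_self, smul_zero]
  rw [Fintype.sum_prod_type] at hpair
  rw [← hpair, diff_eq]
  refine Finset.sum_congr rfl fun j _ => ?_
  rw [diff_eq, map_sum, Finset.smul_sum]
  refine Finset.sum_congr rfl fun l _ => ?_
  rw [map_smul, smul_smul]

/-- By the Clifford relations only the `j`-th summand survives: `wedge K j` is a null-homotopy of
multiplication by `X j`. -/
lemma diff_wedge (j : Fin n) (c : Finset (Fin n) → P) :
    diff K (wedge K j c) =
      (MvPolynomial.X j : MvPolynomial (Fin n) K) • c - wedge K j (diff K c) := by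
  rw [diff_eq, diff_eq, map_sum, eq_sub_iff_add_eq, ← Finset.sum_add_distrib,
    Finset.sum_eq_single j]
  · rw [map_smul, ← smul_add, contr_wedge_self]
  · intro l _ hl
    rw [map_smul, contr_wedge l j hl, smul_neg, neg_add_cancel]
  · simp

lemma diff_comp (φ : P →ₗ[MvPolynomial (Fin n) K] Q) (c : Finset (Fin n) → P) :
    diff K (fun L => φ (c L)) = fun L => φ (diff K c L) := by
  ext L
  simp only [diff_apply, map_sum, map_smul]
  refine Finset.sum_congr rfl fun j _ => ?_
  rw [contr_apply, contr_apply]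
  split_ifs <;> simp

/-- The differential does not see the value at the empty set. -/
lemma diff_congr (c c' : Finset (Fin n) → P) (h : ∀ L, L ≠ ∅ → c L = c' L) :
    diff K c = diff K c' := by
  ext L
  simp only [diff_apply, contr_apply]
  exact Finset.sum_congr rfl fun j _ => by rw [h _ (Finset.insert_ne_empty j L)]

lemma diff_empty (c : Finset (Fin n) → P) :
    diff K c ∅ = ∑ j, (MvPolynomial.X j : MvPolynomial (Fin n) K) • c {j} := by
  simp [diff_apply, contr_apply, sign]

/-! ### Chains in a subset of the variables, and acyclicity from regularity. -/

/-- The chain vanishes on all sets that are not contained in `D`. -/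
def SupportedOn (D : Finset (Fin n)) (c : Finset (Fin n) → P) : Prop :=
  ∀ L, ¬ L ⊆ D → c L = 0

lemma SupportedOn.add {D : Finset (Fin n)} {c c' : Finset (Fin n) → P} (h : SupportedOn D c)
    (h' : SupportedOn D c') : SupportedOn D (c + c') := fun L hL => by simp [h L hL, h' L hL]

lemma SupportedOn.sub {D : Finset (Fin n)} {c c' : Finset (Fin n) → P} (h : SupportedOn D c)
    (h' : SupportedOn D c') : SupportedOn D (c - c') := fun L hL => by simp [h L hL, h' L hL]

lemma SupportedOn.smul {D : Finset (Fin n)} {c : Finset (Fin n) → P} (h : SupportedOn D c)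
    (r : MvPolynomial (Fin n) K) : SupportedOn D (r • c) := fun L hL => by simp [h L hL]

lemma SupportedOn.mono {D D' : Finset (Fin n)} {c : Finset (Fin n) → P} (h : SupportedOn D c)
    (hD : D ⊆ D') : SupportedOn D' c := fun L hL => h L fun h' => hL (h'.trans hD)

lemma SupportedOn.contr {D : Finset (Fin n)} {c : Finset (Fin n) → P} (h : SupportedOn D c)
    (j : Fin n) : SupportedOn (D.erase j) (contr K j c) := by
  intro L hL
  rw [contr_apply]
  split_ifs with hj
  · rfl
  · rw [h, smul_zero]
    intro h'
    refine hL fun l hl => ?_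
    rw [Finset.mem_erase]
    exact ⟨fun e => hj (e ▸ hl), h' (Finset.mem_insert_of_mem hl)⟩

lemma SupportedOn.diff {D : Finset (Fin n)} {c : Finset (Fin n) → P} (h : SupportedOn D c) :
    SupportedOn D (diff K c) := by
  intro L hL
  rw [diff_apply]
  refine Finset.sum_eq_zero fun j _ => ?_
  rw [(h.contr (K := K) j).mono (Finset.erase_subset _ _) L hL, smul_zero]

lemma SupportedOn.wedge {D : Finset (Fin n)} {c : Finset (Fin n) → P} (h : SupportedOn D c)
    (j : Fin n) : SupportedOn (insert j D) (wedge K j c) := by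
  intro L hL
  rw [wedge_apply]
  split_ifs with hj
  · rw [h, smul_zero]
    rwa [← Finset.subset_insert_iff]
  · rfl

/-- Subtracting `wedge K j (contr K j c)` removes exactly the coefficients on sets containing `j`.
-/
lemma SupportedOn.sub_wedge_contr {D : Finset (Fin n)} {j : Fin n} {c : Finset (Fin n) → P}
    (h : SupportedOn (insert j D) c) : SupportedOn D (c - Koszul.wedge K j (Koszul.contr K j c)) := by
  intro L hL
  rw [Pi.sub_apply, wedge_apply]
  split_ifs with hj
  · rw [contr_apply, if_neg (by simp), smul_smul, Finset.insert_erase hj,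
      ← sign_insert_self j (L.erase j), Finset.insert_erase hj, sign_mul_self, one_smul, sub_self]
  · rw [h L, sub_zero]
    rwa [Finset.subset_insert_iff_of_notMem hj]

/-- The submodule `(X_l : l ∈ D) P`. -/
def varSpan (K : Type*) [Field K] {n : ℕ} (P : Type*) [AddCommGroup P]
    [Module (MvPolynomial (Fin n) K) P] (D : Finset (Fin n)) :
    Submodule (MvPolynomial (Fin n) K) P :=
  LinearMap.range (∑ l ∈ D, (MvPolynomial.X l : MvPolynomial (Fin n) K) •
    (LinearMap.proj l : (Fin n → P) →ₗ[MvPolynomial (Fin n) K] P))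

lemma mem_varSpan {D : Finset (Fin n)} {x : P} :
    x ∈ varSpan K P D ↔
      ∃ g : Fin n → P, ∑ l ∈ D, (MvPolynomial.X l : MvPolynomial (Fin n) K) • g l = x := by
  simp [varSpan, LinearMap.mem_range]

/-- If the variables form a regular sequence on `P` in any order, then the Koszul complex of `P`
with respect to any set of variables is acyclic in positive degrees. -/
theorem exists_diff_eq_of_regular
    (hP : ∀ (D : Finset (Fin n)) (j : Fin n), j ∉ D → ∀ f : P,
      (MvPolynomial.X j : MvPolynomial (Fin n) K) • f ∈ varSpan K P D → f ∈ varSpan K P D)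
    (D : Finset (Fin n)) (z : Finset (Fin n) → P) (hz : SupportedOn D z)
    (hd : diff K z = 0) (h0 : z ∅ = 0) : ∃ w, SupportedOn D w ∧ w ∅ = 0 ∧ diff K w = z := by
  induction D using Finset.induction_on generalizing z with
  | empty =>
    refine ⟨0, fun L _ => rfl, rfl, ?_⟩
    rw [map_zero]
    ext L
    by_cases hL : L = ∅
    · rw [hL, h0]; rfl
    · rw [hz L (by simpa using hL)]; rfl
  | insert j D hj ih =>
    have hz'' : SupportedOn D (contr K j z) := by
      simpa [Finset.erase_insert hj] using hz.contr (K := K) j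
    have hd'' : diff K (contr K j z) = 0 := by
      have := contr_diff (K := K) j z
      rw [hd, map_zero] at this
      exact neg_eq_zero.1 this.symm
    -- The coefficient of `diff K z = 0` at `∅` expresses `X j` times this element through the
    -- variables in `D`; regularity cancels `X j`.
    have hmem : contr K j z ∅ ∈ varSpan K P D := by
      apply hP D j hj
      have h1 := congrFun hd ∅
      rw [diff_apply, ← Finset.add_sum_erase _ _ (Finset.mem_univ j)] at h1
      rw [eq_neg_of_add_eq_zero_left h1]
      refine Submodule.neg_mem _ (mem_varSpan.2 ⟨fun l => contr K l z ∅, ?_⟩)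
      refine Finset.sum_subset (fun l hl => ?_) fun l hl hl' => ?_
      · simpa using fun e : l = j => hj (e ▸ hl)
      · have : l ≠ j := by simpa using hl
        have h2 : SupportedOn (insert j D) z := hz
        have h3 : contr K l z ∅ = 0 := by
          rw [contr_apply, if_neg (by simp), h2, smul_zero]
          simp [this, hl']
        simp [h3]
    obtain ⟨g, hg⟩ := mem_varSpan.1 hmem
    classical
    -- A chain of homological degree one whose boundary corrects the value of `contr K j z` at `∅`,
    -- which the induction hypothesis requires to be zero.
    let u₀ : Finset (Fin n) → P := fun L => ∑ l ∈ D, if L = {l} then g l else 0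
    have hu₀ : SupportedOn D u₀ := by
      intro L hL
      refine Finset.sum_eq_zero fun l hl => if_neg ?_
      rintro rfl
      exact hL (by simpa using hl)
    have hu₀0 : u₀ ∅ = 0 := Finset.sum_eq_zero fun l _ =>
      if_neg (Finset.singleton_ne_empty l).symm
    have hu₀' : diff K u₀ ∅ = contr K j z ∅ := by
      rw [diff_empty, ← hg]
      refine (Finset.sum_subset (Finset.subset_univ D) fun l _ hl => ?_).symm.trans
        (Finset.sum_congr rfl fun l hl => ?_)
      · rw [hu₀ {l} (by simpa using hl), smul_zero]
      · congr 1
        simp [u₀, hl]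
    obtain ⟨u₁, hu₁, hu₁0, hu₁'⟩ := ih (contr K j z - diff K u₀) (hz''.sub hu₀.diff)
      (by rw [map_sub, hd'', diff_diff, sub_zero]) (by simp [hu₀'])
    have hu : diff K (u₀ + u₁) = contr K j z := by rw [map_add, hu₁']; abel
    -- Since `contr K j z` is the boundary of `u₀ + u₁`, adding this boundary cancels every term of
    -- `z` involving `j`, leaving a cycle over `D`.
    have hsum : z + diff K (wedge K j (u₀ + u₁)) =
        (z - wedge K j (contr K j z)) + (MvPolynomial.X j : MvPolynomial (Fin n) K) • (u₀ + u₁) := by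
      rw [diff_wedge, hu]; abel
    obtain ⟨w, hw, hw0, hw'⟩ := ih (z + diff K (wedge K j (u₀ + u₁)))
      (by rw [hsum]; exact hz.sub_wedge_contr.add ((hu₀.add hu₁).smul _))
      (by rw [map_add, hd, diff_diff, add_zero])
      (by rw [hsum]; simp [h0, hu₀0, hu₁0, wedge_apply])
    refine ⟨w - wedge K j (u₀ + u₁), (hw.mono (Finset.subset_insert _ _)).sub
      ((hu₀.add hu₁).wedge j), by simp [hw0, wedge_apply], ?_⟩
    rw [map_sub, hw']; abel

end Koszul

/-! ### Acyclicity for free modules; vanishing by dimension shift. -/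

namespace Koszul

section Free

variable {K : Type*} [Field K] {n : ℕ}

lemma mem_varSpan_self {D : Finset (Fin n)} {q : MvPolynomial (Fin n) K} :
    q ∈ varSpan K (MvPolynomial (Fin n) K) D ↔ ∀ m ∈ q.support, ∃ i ∈ D, m i ≠ 0 := by
  rw [mem_varSpan]
  refine Iff.trans ?_ (MvPolynomial.mem_ideal_span_X_image (s := (D : Set (Fin n))))
  rw [Ideal.span, Submodule.mem_span_image_finset_iff_exists_fun']
  simp only [smul_eq_mul, mul_comm]

lemma mem_varSpan_finsupp {ι : Type*} {D : Finset (Fin n)}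
    {f : ι →₀ MvPolynomial (Fin n) K} :
    f ∈ varSpan K (ι →₀ MvPolynomial (Fin n) K) D ↔
      ∀ i, f i ∈ varSpan K (MvPolynomial (Fin n) K) D := by
  constructor
  · intro h i
    obtain ⟨g, rfl⟩ := mem_varSpan.1 h
    exact mem_varSpan.2 ⟨fun l => g l i, by simp [Finsupp.finsetSum_apply]⟩
  · intro h
    rw [← Finsupp.sum_single f]
    refine Submodule.sum_mem _ fun i _ => ?_
    obtain ⟨g, hg⟩ := mem_varSpan.1 (h i)
    refine mem_varSpan.2 ⟨fun l => Finsupp.single i (g l), ?_⟩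
    rw [← hg, ← Finsupp.singleAddHom_apply, map_sum]
    simp

/-- Membership in `(X l : l ∈ D)` is tested monomial by monomial on the exponents in `D`, and
multiplying by `X j` with `j ∉ D` leaves those unchanged. -/
lemma regular_finsupp (ι : Type*) (D : Finset (Fin n)) (j : Fin n) (hj : j ∉ D)
    (f : ι →₀ MvPolynomial (Fin n) K)
    (hf : (MvPolynomial.X j : MvPolynomial (Fin n) K) • f ∈
      varSpan K (ι →₀ MvPolynomial (Fin n) K) D) :
    f ∈ varSpan K (ι →₀ MvPolynomial (Fin n) K) D := by
  rw [mem_varSpan_finsupp] at hf ⊢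
  intro i
  rw [mem_varSpan_self]
  intro m hm
  obtain ⟨l, hl, hl'⟩ := mem_varSpan_self.1 (hf i) (Finsupp.single j 1 + m) (by
    rw [Finsupp.smul_apply, smul_eq_mul, MvPolynomial.mem_support_iff, MvPolynomial.coeff_X_mul]
    exact MvPolynomial.mem_support_iff.1 hm)
  refine ⟨l, hl, ?_⟩
  have hlj : j ≠ l := fun e => hj (e ▸ hl)
  simpa [Finsupp.single_eq_of_ne hlj.symm] using hl'

/-- The Koszul complex of a free module is acyclic in positive degrees. -/
theorem exists_diff_eq_finsupp {ι : Type*} (D : Finset (Fin n))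
    (z : Finset (Fin n) → ι →₀ MvPolynomial (Fin n) K) (hz : SupportedOn D z)
    (hd : diff K z = 0) (h0 : z ∅ = 0) : ∃ w, SupportedOn D w ∧ diff K w = z := by
  obtain ⟨w, hw, -, hw'⟩ := exists_diff_eq_of_regular (regular_finsupp ι) D z hz hd h0
  exact ⟨w, hw, hw'⟩

end Free

section Vanishing

variable {K : Type*} [Field K] {n : ℕ}
  {P : Type*} [AddCommGroup P] [Module (MvPolynomial (Fin n) K) P]
  {Q : Type*} [AddCommGroup Q] [Module (MvPolynomial (Fin n) K) Q]

/-- The part of a chain in homological degree `i`. -/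
def cardPart (i : ℕ) (c : Finset (Fin n) → P) : Finset (Fin n) → P :=
  fun L => if L.card = i then c L else 0

lemma cardPart_of_card_ne {i : ℕ} (c : Finset (Fin n) → P) {L : Finset (Fin n)}
    (h : L.card ≠ i) : cardPart i c L = 0 := if_neg h

lemma cardPart_eq_self {i : ℕ} {c : Finset (Fin n) → P} (h : ∀ L, L.card ≠ i → c L = 0) :
    cardPart i c = c := by
  ext L
  by_cases hL : L.card = i
  · exact if_pos hL
  · rw [cardPart_of_card_ne c hL, h L hL]

lemma diff_cardPart (i : ℕ) (c : Finset (Fin n) → P) :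
    diff K (cardPart (i + 1) c) = cardPart i (diff K c) := by
  ext L
  have h : ∀ j, contr K j (cardPart (i + 1) c) L = cardPart i (contr K j c) L := by
    intro j
    unfold cardPart
    simp only [contr_apply]
    by_cases hj : j ∈ L
    · simp [hj]
    · simp only [hj, if_false, Finset.card_insert_of_notMem hj, add_left_inj]
      split_ifs <;> simp
  rw [diff_apply]
  simp only [h]
  unfold cardPart
  split_ifs <;> simp [diff_apply]

/-- Lifting zero to zero preserves both the support and the homological degree. -/
lemma exists_lift (φ : P →ₗ[MvPolynomial (Fin n) K] Q) (c : Finset (Fin n) → Q)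
    (hc : ∀ L, c L ∈ LinearMap.range φ) :
    ∃ c' : Finset (Fin n) → P, (∀ L, φ (c' L) = c L) ∧ ∀ L, c L = 0 → c' L = 0 := by
  classical
  choose f hf using hc
  refine ⟨fun L => if c L = 0 then 0 else f L, fun L => ?_, fun L hL => if_pos hL⟩
  by_cases h : c L = 0
  · simp [h]
  · simpa [h] using hf L

/-- The `i`-th Koszul homology of `Z` with respect to the variables in `D` vanishes. -/
def HomologyVanishes (D : Finset (Fin n)) (Z : Submodule (MvPolynomial (Fin n) K) P) (i : ℕ) :
    Prop :=
  ∀ z : Finset (Fin n) → P, (∀ L, z L ∈ Z) → SupportedOn D z → (∀ L, L.card ≠ i → z L = 0) →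
    diff K z = 0 → ∃ w, (∀ L, w L ∈ Z) ∧ SupportedOn D w ∧ diff K w = z

lemma homologyVanishes_of_card_lt {D : Finset (Fin n)} (Z : Submodule (MvPolynomial (Fin n) K) P)
    {i : ℕ} (h : D.card < i) : HomologyVanishes D Z i := by
  intro z _ hz hc _
  refine ⟨0, fun _ => Z.zero_mem, fun _ _ => rfl, ?_⟩
  rw [map_zero]
  ext L
  by_cases hL : L ⊆ D
  · rw [hc L (by have := Finset.card_le_card hL; lia)]; rfl
  · rw [hz L hL]; rfl

/-- In the free module `z` is the boundary of some `w`. The image of `w` under `φ` is a cycle, hence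
bounds a chain with a lift `v`, and `w - diff K v` is a preimage of `z` inside the kernel. -/
lemma homologyVanishes_ker {ι : Type*} {D : Finset (Fin n)} {i : ℕ} (hi : i ≠ 0)
    (φ : (ι →₀ MvPolynomial (Fin n) K) →ₗ[MvPolynomial (Fin n) K] Q)
    (h : HomologyVanishes D (LinearMap.range φ) (i + 1)) :
    HomologyVanishes D (LinearMap.ker φ) i := by
  intro z hz hD hc hd
  obtain ⟨w₀, hw₀D, hw₀⟩ := exists_diff_eq_finsupp D z hD hd (hc ∅ (by simpa using hi.symm))
  -- The hypothesis on the range only concerns chains of one homological degree.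
  set w := cardPart (i + 1) w₀ with hwdef
  have hw : diff K w = z := by rw [hwdef, diff_cardPart, hw₀, cardPart_eq_self hc]
  have hwD : SupportedOn D w := fun L hL => by simp [hwdef, cardPart, hw₀D L hL]
  obtain ⟨v', hv'Z, hv'D, hv'⟩ := h (fun L => φ (w L)) (fun L => ⟨_, rfl⟩)
    (fun L hL => by simp [hwD L hL]) (fun L hL => by simp [hwdef, cardPart_of_card_ne _ hL])
    (by rw [diff_comp, hw]; ext L; exact hz L)
  obtain ⟨v, hv, hv0⟩ := exists_lift φ v' hv'Z
  refine ⟨w - diff K v, fun L => ?_, hwD.sub (SupportedOn.diff fun L hL => hv0 L (hv'D L hL)), ?_⟩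
  · have h1 := congrFun (diff_comp φ v) L
    simp only [hv] at h1
    rw [LinearMap.mem_ker, Pi.sub_apply, map_sub, ← h1]
    exact sub_eq_zero.2 (congrFun hv' L).symm
  · rw [map_sub, hw, diff_diff, sub_zero]

lemma HomologyVanishes.of_injective {D : Finset (Fin n)} {i : ℕ}
    (ψ : P →ₗ[MvPolynomial (Fin n) K] Q) (hψ : Function.Injective ψ)
    (h : HomologyVanishes D (LinearMap.range ψ) i) :
    HomologyVanishes D (⊤ : Submodule (MvPolynomial (Fin n) K) P) i := by
  intro z _ hD hc hd
  obtain ⟨w', hw'Z, hw'D, hw'⟩ := h (fun L => ψ (z L)) (fun L => ⟨_, rfl⟩)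
    (fun L hL => by simp [hD L hL]) (fun L hL => by simp [hc L hL])
    (by rw [diff_comp, hd]; ext L; simp)
  obtain ⟨w, hw, hw0⟩ := exists_lift ψ w' hw'Z
  refine ⟨w, fun _ => trivial, fun L hL => hw0 L (hw'D L hL), ?_⟩
  ext L
  apply hψ
  have h1 := congrFun (diff_comp ψ w) L
  simp only [hw] at h1
  rw [← h1]
  exact congrFun hw' L

end Vanishing

end Koszul

/-! ### Koszul homology of syzygies. -/

namespace GradedFreeResolution

variable {K : Type*} [Field K] {n : ℕ} {N : Type*} [AddCommGroup N] [Module K N]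
  [Module (MvPolynomial (Fin n) K) N] {𝒩 : (Fin n → ℤ) → Submodule K N}

open Koszul

lemma ker_aug (F : GradedFreeResolution 𝒩) : LinearMap.ker F.aug = LinearMap.range (F.d 0) :=
  LinearMap.exact_iff.1 F.exact_zero

lemma ker_d (F : GradedFreeResolution 𝒩) (i : ℕ) :
    LinearMap.ker (F.d i) = LinearMap.range (F.d (i + 1)) :=
  LinearMap.exact_iff.1 (F.exact_succ i)

lemma range_aug (F : GradedFreeResolution 𝒩) : LinearMap.range F.aug = ⊤ :=
  LinearMap.range_eq_top.2 F.aug_surjective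

lemma homologyVanishes_range_d (F : GradedFreeResolution 𝒩) (k : ℕ) {D : Finset (Fin n)} {i : ℕ}
    (hi : i ≠ 0) (hD : D.card < i + (k + 1)) : HomologyVanishes D (LinearMap.range (F.d k)) i := by
  induction k generalizing i with
  | zero =>
    rw [← F.ker_aug]
    exact homologyVanishes_ker hi _ (homologyVanishes_of_card_lt _ hD)
  | succ k ih =>
    rw [← F.ker_d]
    exact homologyVanishes_ker hi _ (ih (Nat.succ_ne_zero i) (by lia))

/-- The Koszul homology of a `k`-th syzygy module in degree `i ≥ 1` vanishes for fewer than `i + k`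
variables. -/
theorem IsSyzygy.homologyVanishes {F : GradedFreeResolution 𝒩} {M : Type*} [AddCommGroup M]
    [Module K M] [Module (MvPolynomial (Fin n) K) M] {ℳ : (Fin n → ℤ) → Submodule K M} {k : ℕ}
    (hM : F.IsSyzygy ℳ k) {D : Finset (Fin n)} {i : ℕ} (hi : i ≠ 0) (hD : D.card < i + k) :
    HomologyVanishes D (⊤ : Submodule (MvPolynomial (Fin n) K) M) i := by
  cases k with
  | zero => exact homologyVanishes_of_card_lt _ hD
  | succ k =>
    obtain ⟨e, -⟩ := hM
    refine HomologyVanishes.of_injective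
      ((LinearMap.range (F.d k)).subtype ∘ₗ e.toLinearMap)
      (Subtype.val_injective.comp e.injective) ?_
    rw [LinearMap.range_comp, LinearEquiv.range, Submodule.map_top, Submodule.range_subtype]
    exact F.homologyVanishes_range_d k hi hD

end GradedFreeResolution

/-! ### Homogeneous components and the irrelevant ideal. -/

namespace Koszul

section HomogPart

variable {K : Type*} [Field K] {n : ℕ}
  {P : Type*} [AddCommGroup P] [Module K P] [Module (MvPolynomial (Fin n) K) P]
  (𝒜 : (Fin n → ℤ) → Submodule K P) [IsMultigraded 𝒜]
  {Q : Type*} [AddCommGroup Q] [Module K Q] [Module (MvPolynomial (Fin n) K) Q]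
  (ℬ : (Fin n → ℤ) → Submodule K Q) [IsMultigraded ℬ]

/-- The projection of a multigraded module to its component of degree `a`. -/
def homogPart (a : Fin n → ℤ) : P →ₗ[K] P :=
  (𝒜 a).subtype ∘ₗ DirectSum.component K _ _ a ∘ₗ
    (LinearEquiv.ofBijective (DirectSum.coeLinearMap 𝒜)
      (IsMultigraded.isInternal (ℳ := 𝒜))).symm.toLinearMap

lemma homogPart_mem (a : Fin n → ℤ) (x : P) : homogPart 𝒜 a x ∈ 𝒜 a := Subtype.property _

variable {𝒜} in
lemma homogPart_of_mem {a : Fin n → ℤ} {x : P} (hx : x ∈ 𝒜 a) : homogPart 𝒜 a x = x :=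
  congrArg Subtype.val ((IsMultigraded.isInternal (ℳ := 𝒜)).ofBijective_coeLinearMap_of_mem hx)

variable {𝒜} in
lemma homogPart_of_mem_ne {a b : Fin n → ℤ} (hab : b ≠ a) {x : P} (hx : x ∈ 𝒜 b) :
    homogPart 𝒜 a x = 0 :=
  congrArg Subtype.val
    ((IsMultigraded.isInternal (ℳ := 𝒜)).ofBijective_coeLinearMap_of_mem_ne hab hx)

lemma homogeneous_induction {p : P → Prop} (hadd : ∀ x y, p x → p y → p (x + y)) (h0 : p 0)
    (h : ∀ a x, x ∈ 𝒜 a → p x) (x : P) : p x := by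
  obtain ⟨s, v, hv, rfl⟩ := exists_sum_homogeneous 𝒜 x
  exact Finset.sum_induction _ _ hadd h0 fun a _ => h a _ (hv a)

variable {𝒜} in
lemma X_smul_mem {b : Fin n → ℤ} {x : P} (hx : x ∈ 𝒜 b) (j : Fin n) :
    (MvPolynomial.X j : MvPolynomial (Fin n) K) • x ∈ 𝒜 (Pi.single j 1 + b) :=
  IsMultigraded.smul_mem _ _ _ _ (MvPolynomial.isWeightedHomogeneous_X _ _ j) hx

lemma homogPart_X_smul (a : Fin n → ℤ) (j : Fin n) (x : P) :
    homogPart 𝒜 a ((MvPolynomial.X j : MvPolynomial (Fin n) K) • x) =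
      (MvPolynomial.X j : MvPolynomial (Fin n) K) • homogPart 𝒜 (a - Pi.single j 1) x := by
  induction x using homogeneous_induction 𝒜 with
  | hadd x y hx hy => simp only [smul_add, map_add, hx, hy]
  | h0 => simp
  | h b x hx =>
    by_cases hb : b = a - Pi.single j 1
    · subst hb
      rw [homogPart_of_mem hx, homogPart_of_mem]
      simpa using X_smul_mem hx j
    · rw [homogPart_of_mem_ne hb hx, smul_zero, homogPart_of_mem_ne ?_ (X_smul_mem hx j)]
      rintro rfl
      exact hb (by simp)

variable {𝒜 ℬ} in
lemma homogPart_map (φ : P →ₗ[MvPolynomial (Fin n) K] Q) (hφ : ∀ a x, x ∈ 𝒜 a → φ x ∈ ℬ a)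
    (a : Fin n → ℤ) (x : P) : homogPart ℬ a (φ x) = φ (homogPart 𝒜 a x) := by
  induction x using homogeneous_induction 𝒜 with
  | hadd x y hx hy => simp only [map_add, hx, hy]
  | h0 => simp
  | h b x hx =>
    by_cases hb : b = a
    · subst hb
      rw [homogPart_of_mem hx, homogPart_of_mem (hφ _ _ hx)]
    · rw [homogPart_of_mem_ne hb hx, homogPart_of_mem_ne hb (hφ _ _ hx), map_zero]

end HomogPart

section Irrelevant

variable {K : Type*} [Field K] {n : ℕ}
  {P : Type*} [AddCommGroup P] [Module (MvPolynomial (Fin n) K) P]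

lemma mem_irrelevant_smul {Z : Submodule (MvPolynomial (Fin n) K) P} {y : P} :
    y ∈ irrelevant K n • Z ↔ ∃ g : Fin n → P, (∀ j, g j ∈ Z) ∧
      ∑ j, (MvPolynomial.X j : MvPolynomial (Fin n) K) • g j = y := by
  constructor
  · intro hy
    induction hy using Submodule.smul_induction_on' with
    | smul r hr m hm =>
      obtain ⟨c, rfl⟩ := Ideal.mem_span_range_iff_exists_fun.1 hr
      refine ⟨fun j => c j • m, fun j => Z.smul_mem _ hm, ?_⟩
      simp only [Finset.sum_smul, smul_smul, mul_comm]
    | add x _ y _ hx hy =>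
      obtain ⟨g, hg, rfl⟩ := hx
      obtain ⟨g', hg', rfl⟩ := hy
      exact ⟨g + g', fun j => Z.add_mem (hg j) (hg' j), by simp [Finset.sum_add_distrib]⟩
  · rintro ⟨g, hg, rfl⟩
    exact Submodule.sum_mem _ fun j _ =>
      Submodule.smul_mem_smul (Ideal.subset_span ⟨j, rfl⟩) (hg j)

lemma mem_irrelevant_smul_iff_diff {Z : Submodule (MvPolynomial (Fin n) K) P} {y : P} :
    y ∈ irrelevant K n • Z ↔
      ∃ w : Finset (Fin n) → P, (∀ L, w L ∈ Z) ∧ diff K w ∅ = y := by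
  classical
  rw [mem_irrelevant_smul]
  constructor
  · rintro ⟨g, hg, rfl⟩
    refine ⟨fun L => ∑ l, if L = {l} then g l else 0, fun L => ?_, ?_⟩
    · refine Submodule.sum_mem _ fun l _ => ?_
      split_ifs
      · exact hg l
      · exact Z.zero_mem
    · rw [diff_empty]
      refine Finset.sum_congr rfl fun j _ => ?_
      simp
  · rintro ⟨w, hw, rfl⟩
    exact ⟨fun j => w {j}, fun j => hw _, (diff_empty w).symm⟩

lemma homogPart_mem_irrelevant_smul [Module K P] (𝒜 : (Fin n → ℤ) → Submodule K P)
    [IsMultigraded 𝒜] (a : Fin n → ℤ) {y : P}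
    (hy : y ∈ irrelevant K n • (⊤ : Submodule (MvPolynomial (Fin n) K) P)) :
    homogPart 𝒜 a y ∈ irrelevant K n • (⊤ : Submodule (MvPolynomial (Fin n) K) P) := by
  obtain ⟨g, -, rfl⟩ := mem_irrelevant_smul.1 hy
  refine mem_irrelevant_smul.2 ⟨fun j => homogPart 𝒜 (a - Pi.single j 1) (g j),
    fun _ => trivial, ?_⟩
  simp only [map_sum, homogPart_X_smul]

end Irrelevant

/-! ### Multigraded Koszul homology and its connecting map. -/

section Chains

variable {K : Type*} [Field K] {n : ℕ}
  {P : Type*} [AddCommGroup P] [Module K P] [Module (MvPolynomial (Fin n) K) P]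
  (𝒜 : (Fin n → ℤ) → Submodule K P) [IsMultigraded 𝒜]
  {Q : Type*} [AddCommGroup Q] [Module K Q] [Module (MvPolynomial (Fin n) K) Q]
  (ℬ : (Fin n → ℤ) → Submodule K Q) [IsMultigraded ℬ]

/-- The degree of `e_L`. -/
def basisDeg (L : Finset (Fin n)) : Fin n → ℤ := ∑ l ∈ L, Pi.single l 1

lemma basisDeg_insert {j : Fin n} {L : Finset (Fin n)} (hj : j ∉ L) :
    basisDeg (insert j L) = Pi.single j 1 + basisDeg L := Finset.sum_insert hj

@[simp]
lemma basisDeg_empty : basisDeg (∅ : Finset (Fin n)) = 0 := rfl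

lemma sum_basisDeg (L : Finset (Fin n)) : ∑ l, basisDeg L l = L.card := by
  unfold basisDeg
  simp only [Finset.sum_apply]
  rw [Finset.sum_comm]
  simp

lemma basisDeg_apply (L : Finset (Fin n)) (l : Fin n) :
    basisDeg L l = if l ∈ L then 1 else 0 := by
  simp [basisDeg, Finset.sum_apply, Pi.single_apply]

/-- Ensures that contractions along different faces land in different multidegrees. -/
lemma basisDeg_injective : Function.Injective (basisDeg (n := n)) := by
  intro L L' h
  ext l
  have := congrFun h l
  rw [basisDeg_apply, basisDeg_apply] at this
  by_cases h1 : l ∈ L <;> by_cases h2 : l ∈ L' <;> simp_all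

/-- The chain is homogeneous of homological degree `i` and multidegree `a`. -/
def IsHomogeneous (i : ℕ) (a : Fin n → ℤ) (c : Finset (Fin n) → P) : Prop :=
  (∀ L, L.card ≠ i → c L = 0) ∧ ∀ L, c L ∈ 𝒜 (a - basisDeg L)

variable {𝒜 ℬ}

lemma IsHomogeneous.contr {i : ℕ} {a : Fin n → ℤ} {c : Finset (Fin n) → P}
    (hc : IsHomogeneous 𝒜 (i + 1) a c) (j : Fin n) :
    IsHomogeneous 𝒜 i (a - Pi.single j 1) (contr K j c) := by
  refine ⟨fun L hL => ?_, fun L => ?_⟩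
  · rw [contr_apply]
    split_ifs with hj
    · rfl
    · rw [hc.1 _ (by rw [Finset.card_insert_of_notMem hj]; lia), smul_zero]
  · rw [contr_apply]
    split_ifs with hj
    · exact Submodule.zero_mem _
    · have := hc.2 (insert j L)
      rw [basisDeg_insert hj, ← sub_sub] at this
      exact zsmul_mem this _

lemma IsHomogeneous.diff {i : ℕ} {a : Fin n → ℤ} {c : Finset (Fin n) → P}
    (hc : IsHomogeneous 𝒜 (i + 1) a c) : IsHomogeneous 𝒜 i a (diff K c) := by
  refine ⟨fun L hL => ?_, fun L => ?_⟩
  · rw [diff_apply]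
    exact Finset.sum_eq_zero fun j _ => by rw [(hc.contr j).1 L hL, smul_zero]
  · rw [diff_apply]
    refine Submodule.sum_mem _ fun j _ => ?_
    convert X_smul_mem ((hc.contr j).2 L) j using 1
    congr 1
    abel

lemma IsHomogeneous.map {i : ℕ} {a : Fin n → ℤ} {c : Finset (Fin n) → P}
    (hc : IsHomogeneous 𝒜 i a c) (φ : P →ₗ[MvPolynomial (Fin n) K] Q)
    (hφ : ∀ a x, x ∈ 𝒜 a → φ x ∈ ℬ a) : IsHomogeneous ℬ i a fun L => φ (c L) :=
  ⟨fun L hL => by simp [hc.1 L hL], fun L => hφ _ _ (hc.2 L)⟩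

lemma diff_homogPart (a : Fin n → ℤ) (c : Finset (Fin n) → P) :
    Koszul.diff K (fun L => homogPart 𝒜 (a - basisDeg L) (c L)) =
      fun L => homogPart 𝒜 (a - basisDeg L) (Koszul.diff K c L) := by
  ext L
  simp only [diff_apply, map_sum, homogPart_X_smul]
  refine Finset.sum_congr rfl fun j _ => ?_
  rw [contr_apply, contr_apply]
  split_ifs with hj
  · simp
  · rw [basisDeg_insert hj, map_zsmul, sub_sub a, add_comm (basisDeg L)]

/-- The differential commutes with projection to a multidegree and to a homological degree, so both
may be applied to `w`. -/
lemma IsHomogeneous.exists_diff_eq {i : ℕ} {a : Fin n → ℤ} {z w : Finset (Fin n) → P}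
    (hz : IsHomogeneous 𝒜 i a z) (hw : Koszul.diff K w = z) :
    ∃ w', IsHomogeneous 𝒜 (i + 1) a w' ∧ Koszul.diff K w' = z := by
  refine ⟨cardPart (i + 1) fun L => homogPart 𝒜 (a - basisDeg L) (w L),
    ⟨fun L hL => cardPart_of_card_ne _ hL, fun L => ?_⟩, ?_⟩
  · unfold cardPart
    split_ifs
    · exact homogPart_mem _ _ _
    · exact Submodule.zero_mem _
  · rw [diff_cardPart, diff_homogPart, hw]
    simp only [homogPart_of_mem (hz.2 _)]
    exact cardPart_eq_self hz.1

lemma IsHomogeneous.exists_lift {i : ℕ} {a : Fin n → ℤ} {z : Finset (Fin n) → Q}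
    (hz : IsHomogeneous ℬ i a z) (φ : P →ₗ[MvPolynomial (Fin n) K] Q)
    (hφ : ∀ a x, x ∈ 𝒜 a → φ x ∈ ℬ a) (hr : ∀ L, z L ∈ LinearMap.range φ) :
    ∃ w, IsHomogeneous 𝒜 i a w ∧ ∀ L, φ (w L) = z L := by
  obtain ⟨w, hw, hw0⟩ := Koszul.exists_lift φ z hr
  refine ⟨fun L => homogPart 𝒜 (a - basisDeg L) (w L), ⟨fun L hL => ?_,
    fun L => homogPart_mem _ _ _⟩, fun L => ?_⟩
  · simp [hw0 L (hz.1 L hL)]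
  · rw [← homogPart_map φ hφ, hw, homogPart_of_mem (hz.2 L)]

variable (𝒜)

/-- The Koszul homology of the submodule `Z` in homological degree `i` and multidegree `a` is
nonzero. -/
def HasHomology (Z : Submodule (MvPolynomial (Fin n) K) P) (i : ℕ) (a : Fin n → ℤ) : Prop :=
  ∃ z, IsHomogeneous 𝒜 i a z ∧ (∀ L, z L ∈ Z) ∧ Koszul.diff K z = 0 ∧
    ¬ ∃ w, (∀ L, w L ∈ Z) ∧ Koszul.diff K w = z

/-- The kernel of the map from the Koszul homology of the submodule `Z` to the Koszul homology of
the whole module is nonzero in homological degree `i` and multidegree `a`. -/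
def HasRelHomology (Z : Submodule (MvPolynomial (Fin n) K) P) (i : ℕ) (a : Fin n → ℤ) : Prop :=
  ∃ z, IsHomogeneous 𝒜 i a z ∧ (∀ L, z L ∈ Z) ∧ (∃ w, Koszul.diff K w = z) ∧
    ¬ ∃ w, (∀ L, w L ∈ Z) ∧ Koszul.diff K w = z

lemma isHomogeneous_single {a : Fin n → ℤ} {y : P} (hy : y ∈ 𝒜 a) :
    IsHomogeneous 𝒜 0 a (Pi.single ∅ y) := by
  refine ⟨fun L hL => Pi.single_eq_of_ne (by simpa using hL) _, fun L => ?_⟩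
  by_cases hL : L = ∅
  · subst hL; simpa using hy
  · rw [Pi.single_eq_of_ne hL]; exact Submodule.zero_mem _

lemma IsHomogeneous.eq_single {a : Fin n → ℤ} {z : Finset (Fin n) → P}
    (hz : IsHomogeneous 𝒜 0 a z) : z = Pi.single ∅ (z ∅) := by
  ext L
  by_cases hL : L = ∅
  · subst hL; simp
  · rw [Pi.single_eq_of_ne hL, hz.1 L (by simpa using hL)]

lemma diff_single_empty (y : P) : Koszul.diff K (Pi.single ∅ y : Finset (Fin n) → P) = 0 := by
  rw [diff_congr _ 0 fun L hL => Pi.single_eq_of_ne hL _, map_zero]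

lemma mem_irrelevant_smul_iff_single {Z : Submodule (MvPolynomial (Fin n) K) P} {y : P} :
    y ∈ irrelevant K n • Z ↔ ∃ w : Finset (Fin n) → P, (∀ L, w L ∈ Z) ∧
      Koszul.diff K w = Pi.single ∅ y := by
  rw [mem_irrelevant_smul_iff_diff]
  constructor
  · rintro ⟨w, hw, hwy⟩
    refine ⟨cardPart 1 w, fun L => ?_, ?_⟩
    · unfold cardPart
      split_ifs
      · exact hw L
      · exact Z.zero_mem
    · rw [diff_cardPart]
      ext L
      by_cases hL : L = ∅
      · subst hL; simp [cardPart, hwy]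
      · rw [Pi.single_eq_of_ne hL, cardPart_of_card_ne _ (by simpa using hL)]
  · rintro ⟨w, hw, hwy⟩
    exact ⟨w, hw, by rw [hwy, Pi.single_eq_same]⟩

lemma single_mem {Z : Submodule (MvPolynomial (Fin n) K) P} {y : P} (hy : y ∈ Z)
    (L : Finset (Fin n)) : (Pi.single ∅ y : Finset (Fin n) → P) L ∈ Z := by
  by_cases hL : L = ∅
  · subst hL; simpa using hy
  · rw [Pi.single_eq_of_ne hL]; exact Z.zero_mem

lemma hasHomology_zero_iff {Z : Submodule (MvPolynomial (Fin n) K) P} {a : Fin n → ℤ} :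
    HasHomology 𝒜 Z 0 a ↔ ∃ y ∈ 𝒜 a, y ∈ Z ∧ y ∉ irrelevant K n • Z := by
  constructor
  · rintro ⟨z, hz, hzZ, -, h⟩
    exact ⟨z ∅, by simpa using hz.2 ∅, hzZ ∅, fun h' => h
      (hz.eq_single ▸ mem_irrelevant_smul_iff_single.1 h')⟩
  · rintro ⟨y, hy, hyZ, h⟩
    exact ⟨Pi.single ∅ y, isHomogeneous_single 𝒜 hy, single_mem hyZ, diff_single_empty y,
      fun h' => h (mem_irrelevant_smul_iff_single.2 h')⟩

lemma hasRelHomology_zero_iff {Z : Submodule (MvPolynomial (Fin n) K) P} {a : Fin n → ℤ} :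
    HasRelHomology 𝒜 Z 0 a ↔ ∃ y ∈ 𝒜 a, y ∈ Z ∧ y ∈ irrelevant K n •
      (⊤ : Submodule (MvPolynomial (Fin n) K) P) ∧ y ∉ irrelevant K n • Z := by
  constructor
  · rintro ⟨z, hz, hzZ, ⟨w, hw⟩, h⟩
    exact ⟨z ∅, by simpa using hz.2 ∅, hzZ ∅,
      mem_irrelevant_smul_iff_diff.2 ⟨w, fun _ => trivial, by rw [hw]⟩, fun h' => h
      (hz.eq_single ▸ mem_irrelevant_smul_iff_single.1 h')⟩
  · rintro ⟨y, hy, hyZ, hyP, h⟩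
    obtain ⟨w, -, hw⟩ := mem_irrelevant_smul_iff_single.1 hyP
    exact ⟨Pi.single ∅ y, isHomogeneous_single 𝒜 hy, single_mem hyZ, ⟨w, hw⟩,
      fun h' => h (mem_irrelevant_smul_iff_single.2 h')⟩

variable {𝒜}

/-- In positive degree every cycle bounds in the ambient free module, so the relative condition is
automatic. -/
lemma hasRelHomology_succ_iff {ι : Type*} {δ : ι → Fin n → ℤ}
    {Z : Submodule (MvPolynomial (Fin n) K) (ι →₀ MvPolynomial (Fin n) K)} {i : ℕ}
    {a : Fin n → ℤ} :
    HasRelHomology (freeComp K δ) Z (i + 1) a ↔ HasHomology (freeComp K δ) Z (i + 1) a := by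
  constructor
  · rintro ⟨z, hz, hzZ, ⟨w, rfl⟩, h⟩
    exact ⟨_, hz, hzZ, diff_diff w, h⟩
  · rintro ⟨z, hz, hzZ, hd, h⟩
    obtain ⟨w, -, hw⟩ := exists_diff_eq_finsupp Finset.univ z
      (fun L hL => absurd (Finset.subset_univ L) hL) hd (hz.1 ∅ (by simp))
    exact ⟨z, hz, hzZ, ⟨w, hw⟩, h⟩

/-- The connecting homomorphism of Koszul homology for the kernel of a map from a free module. -/
theorem hasHomology_range_iff {ι : Type*} {δ : ι → Fin n → ℤ}
    (φ : (ι →₀ MvPolynomial (Fin n) K) →ₗ[MvPolynomial (Fin n) K] Q)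
    (hφ : ∀ a x, x ∈ freeComp K δ a → φ x ∈ ℬ a) {i : ℕ} {a : Fin n → ℤ} :
    HasHomology ℬ (LinearMap.range φ) (i + 1) a ↔
      HasRelHomology (freeComp K δ) (LinearMap.ker φ) i a := by
  constructor
  · rintro ⟨z, hz, hzZ, hd, h⟩
    obtain ⟨w, hw, hwz⟩ := hz.exists_lift φ hφ hzZ
    refine ⟨Koszul.diff K w, hw.diff, fun L => ?_, ⟨w, rfl⟩, ?_⟩
    · have h1 := congrFun (diff_comp φ w) L
      simp only [hwz] at h1
      rw [LinearMap.mem_ker, ← h1]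
      exact congrFun hd L
    · rintro ⟨v, hv, hvw⟩
      -- The differential ignores the value at `∅`, so it is erased from `v` to meet the hypothesis
      -- of acyclicity. The difference is a cycle, thus a boundary, and `φ` sends it to `z`.
      obtain ⟨u, -, hu⟩ := exists_diff_eq_finsupp Finset.univ
        (w - Function.update v ∅ 0) (fun L hL => absurd (Finset.subset_univ L) hL)
        (by
          rw [map_sub, ← hvw, sub_eq_zero]
          exact diff_congr _ _ fun L hL => (Function.update_of_ne hL _ _).symm)
        (by simp [hw.1 ∅ (by simp)])
      refine h ⟨fun L => φ (u L), fun L => ⟨_, rfl⟩, ?_⟩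
      rw [diff_comp, hu]
      ext L
      rw [Pi.sub_apply, map_sub, hwz]
      by_cases hL : L = ∅
      · simp [hL]
      · rw [Function.update_of_ne hL, LinearMap.mem_ker.1 (hv L), sub_zero]
  · rintro ⟨y, hy, hyZ, ⟨w₀, hw₀⟩, h⟩
    obtain ⟨w, hw, hwy⟩ := hy.exists_diff_eq hw₀
    refine ⟨fun L => φ (w L), hw.map φ hφ, fun L => ⟨_, rfl⟩, ?_, ?_⟩
    · rw [diff_comp, hwy]
      ext L
      exact hyZ L
    · rintro ⟨v', hv', hvw⟩
      obtain ⟨v, hv, -⟩ := Koszul.exists_lift φ v' hv'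
      refine h ⟨w - Koszul.diff K v, fun L => ?_, by rw [map_sub, diff_diff, hwy, sub_zero]⟩
      have h1 := congrFun (diff_comp φ v) L
      simp only [hv] at h1
      rw [LinearMap.mem_ker, Pi.sub_apply, map_sub, ← h1, hvw, sub_self]

end Chains

end Koszul

/-! ### Comparison of Tor with Koszul homology. -/

namespace GradedFreeResolution

variable {K : Type*} [Field K] {n : ℕ} {M : Type*} [AddCommGroup M] [Module K M]
  [Module (MvPolynomial (Fin n) K) M] {ℳ : (Fin n → ℤ) → Submodule K M}

open Koszul

/-- The map `F_i → K ⊗_S F_i`. -/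
def toFiber (F : GradedFreeResolution ℳ) (i : ℕ) :
    (F.ι i →₀ MvPolynomial (Fin n) K) →ₗ[K] F.Fiber i :=
  (TensorProduct.mk (MvPolynomial (Fin n) K) (MvPolynomial (Fin n) K ⧸ irrelevant K n)
      (F.ι i →₀ MvPolynomial (Fin n) K) 1).restrictScalars K

lemma toFiber_eq_zero_iff (F : GradedFreeResolution ℳ) (i : ℕ)
    (f : F.ι i →₀ MvPolynomial (Fin n) K) :
    F.toFiber i f = 0 ↔ f ∈ irrelevant K n •
      (⊤ : Submodule (MvPolynomial (Fin n) K) (F.ι i →₀ MvPolynomial (Fin n) K)) := by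
  rw [← Submodule.Quotient.mk_eq_zero]
  have h := TensorProduct.quotTensorEquivQuotSMul_mk_tmul
    (M := F.ι i →₀ MvPolynomial (Fin n) K) (irrelevant K n) 1 f
  rw [one_smul] at h
  rw [← h]
  exact (LinearEquiv.map_eq_zero_iff _).symm

lemma fiberD_toFiber (F : GradedFreeResolution ℳ) (i : ℕ)
    (f : F.ι (i + 1) →₀ MvPolynomial (Fin n) K) :
    F.fiberD i (F.toFiber (i + 1) f) = F.toFiber i (F.d i f) := rfl

lemma toFiber_mem_boundaries_iff (F : GradedFreeResolution ℳ) {i : ℕ} {a : Fin n → ℤ}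
    {f : F.ι i →₀ MvPolynomial (Fin n) K} (hf : f ∈ freeComp K (F.deg i) a) :
    F.toFiber i f ∈ F.boundaries i a ↔ f ∈ (irrelevant K n •
      (⊤ : Submodule (MvPolynomial (Fin n) K) (F.ι i →₀ MvPolynomial (Fin n) K))) ⊔
        LinearMap.range (F.d i) := by
  constructor
  · rintro ⟨_, ⟨g, hg, rfl⟩, h⟩
    change F.toFiber i (F.d i g) = _ at h
    rw [eq_comm, ← sub_eq_zero, ← map_sub, toFiber_eq_zero_iff] at h
    have := Submodule.add_mem_sup h (LinearMap.mem_range_self (F.d i) g)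
    rwa [sub_add_cancel] at this
  · intro h
    obtain ⟨y, hy, _, ⟨g, rfl⟩, hf'⟩ := Submodule.mem_sup.1 h
    refine ⟨F.toFiber (i + 1) (homogPart (freeComp K (F.deg (i + 1))) a g),
      ⟨_, homogPart_mem _ _ _, rfl⟩, ?_⟩
    rw [fiberD_toFiber, eq_comm, ← sub_eq_zero, ← map_sub, toFiber_eq_zero_iff,
      ← homogPart_map (F.d i) (F.d_mem i)]
    nth_rewrite 1 [← homogPart_of_mem hf]
    rw [← map_sub, ← hf', add_sub_cancel_right]
    exact homogPart_mem_irrelevant_smul _ _ hy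

lemma mem_sup_ker_iff {P Q : Type*} [AddCommGroup P] [Module (MvPolynomial (Fin n) K) P]
    [AddCommGroup Q] [Module (MvPolynomial (Fin n) K) Q] (φ : P →ₗ[MvPolynomial (Fin n) K] Q)
    (f : P) : f ∈ (irrelevant K n • (⊤ : Submodule (MvPolynomial (Fin n) K) P)) ⊔
      LinearMap.ker φ ↔ φ f ∈ irrelevant K n • LinearMap.range φ := by
  rw [← Submodule.comap_map_eq, Submodule.map_smul'', Submodule.map_top, Submodule.mem_comap]

lemma nontrivial_tor_iff (F : GradedFreeResolution ℳ) (i : ℕ) (a : Fin n → ℤ) :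
    Nontrivial (F.Tor i a) ↔ ¬ F.cycles i a ≤ F.boundaries i a := by
  rw [Submodule.Quotient.nontrivial_iff, Ne, Submodule.submoduleOf, Submodule.comap_subtype_eq_top]

lemma nontrivial_tor_zero_iff [IsMultigraded ℳ] (F : GradedFreeResolution ℳ) (a : Fin n → ℤ) :
    Nontrivial (F.Tor 0 a) ↔ HasHomology ℳ ⊤ 0 a := by
  rw [nontrivial_tor_iff, hasHomology_zero_iff, SetLike.not_le_iff_exists]
  constructor
  · rintro ⟨_, ⟨f, hf, rfl⟩, h⟩
    refine ⟨F.aug f, F.aug_mem a f hf, trivial, fun h' => h ?_⟩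
    refine (F.toFiber_mem_boundaries_iff hf).2 ?_
    rwa [← F.ker_aug, mem_sup_ker_iff, F.range_aug]
  · rintro ⟨y, hy, -, h⟩
    obtain ⟨f, rfl⟩ := F.aug_surjective y
    refine ⟨F.toFiber 0 (homogPart (freeComp K (F.deg 0)) a f), ⟨_, homogPart_mem _ _ _, rfl⟩,
      fun h' => h ?_⟩
    rw [F.toFiber_mem_boundaries_iff (homogPart_mem _ _ _), ← F.ker_aug, mem_sup_ker_iff,
      F.range_aug, ← homogPart_map F.aug F.aug_mem, homogPart_of_mem hy] at h'
    exact h'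

/-- Apply `F.d i` to a chain `f`: it is a cycle in the fiber when the image lies in `𝔪 F_i`, and a
boundary when the image lies in `𝔪` times the range, where `𝔪` is the irrelevant ideal. -/
lemma nontrivial_tor_succ_iff (F : GradedFreeResolution ℳ) (i : ℕ) (a : Fin n → ℤ) :
    Nontrivial (F.Tor (i + 1) a) ↔
      HasRelHomology (freeComp K (F.deg i)) (LinearMap.range (F.d i)) 0 a := by
  rw [nontrivial_tor_iff, hasRelHomology_zero_iff, SetLike.not_le_iff_exists]
  constructor
  · rintro ⟨_, ⟨⟨f, hf, rfl⟩, hd⟩, h⟩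
    refine ⟨F.d i f, F.d_mem i a f hf, ⟨f, rfl⟩, (F.toFiber_eq_zero_iff i _).1 hd,
      fun h' => h ?_⟩
    refine (F.toFiber_mem_boundaries_iff hf).2 ?_
    rwa [← F.ker_d, mem_sup_ker_iff]
  · rintro ⟨y, hy, ⟨f, rfl⟩, hm, h⟩
    have hf := homogPart_map (F.d i) (F.d_mem i) a f
    rw [homogPart_of_mem hy] at hf
    refine ⟨F.toFiber (i + 1) (homogPart (freeComp K (F.deg (i + 1))) a f),
      ⟨⟨_, homogPart_mem _ _ _, rfl⟩, ?_⟩, fun h' => h ?_⟩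
    · change F.fiberD i _ = 0
      rw [fiberD_toFiber, toFiber_eq_zero_iff, ← hf]
      exact hm
    · rwa [F.toFiber_mem_boundaries_iff (homogPart_mem _ _ _), ← F.ker_d, mem_sup_ker_iff,
        ← hf] at h'

/-- Each connecting map trades one Koszul degree for one step in the resolution. -/
lemma hasRelHomology_range_d_iff (F : GradedFreeResolution ℳ) {i j m : ℕ} (hm : i + j = m)
    (a : Fin n → ℤ) :
    HasRelHomology (freeComp K (F.deg i)) (LinearMap.range (F.d i)) j a ↔
      HasRelHomology (freeComp K (F.deg m)) (LinearMap.range (F.d m)) 0 a := by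
  induction j generalizing i with
  | zero => subst hm; rfl
  | succ j ih =>
    rw [hasRelHomology_succ_iff, hasHomology_range_iff (F.d i) (F.d_mem i), F.ker_d,
      ih (by lia)]

/-- The multigraded pieces of `Tor`, computed from a free resolution, are nonzero exactly where the
Koszul homology is. -/
theorem nontrivial_tor_iff_hasHomology [IsMultigraded ℳ] (F : GradedFreeResolution ℳ) (i : ℕ)
    (a : Fin n → ℤ) : Nontrivial (F.Tor i a) ↔ HasHomology ℳ ⊤ i a := by
  cases i with
  | zero => exact F.nontrivial_tor_zero_iff a
  | succ i =>
    rw [F.nontrivial_tor_succ_iff, ← F.range_aug, hasHomology_range_iff F.aug F.aug_mem,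
      F.ker_aug, hasRelHomology_range_d_iff F (zero_add i)]

end GradedFreeResolution

namespace Koszul

/-! ### Lower bound for the degrees of a finitely generated module. -/

section DegreeBound

variable {K : Type*} [Field K] {n : ℕ}
  {P : Type*} [AddCommGroup P] [Module K P] [Module (MvPolynomial (Fin n) K) P]
  [IsScalarTower K (MvPolynomial (Fin n) K) P]
  (𝒜 : (Fin n → ℤ) → Submodule K P) [IsMultigraded 𝒜]

/-- The submodule of all elements whose homogeneous components have total degree at least `B`. -/
def totalDegreeGE (B : ℤ) : Submodule (MvPolynomial (Fin n) K) P where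
  carrier := {x | ∀ c : Fin n → ℤ, ∑ l, c l < B → homogPart 𝒜 c x = 0}
  add_mem' hx hy c hc := by rw [map_add, hx c hc, hy c hc, add_zero]
  zero_mem' c _ := map_zero _
  smul_mem' r x hx := by
    induction r using MvPolynomial.induction_on with
    | C r =>
      intro c hc
      rw [← MvPolynomial.algebraMap_eq, algebraMap_smul, map_smul, hx c hc, smul_zero]
    | add p q hp hq =>
      intro c hc
      rw [add_smul, map_add, hp c hc, hq c hc, add_zero]
    | mul_X p j hp =>
      intro c hc
      rw [mul_comm, mul_smul, homogPart_X_smul, hp, smul_zero]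
      simp only [Pi.sub_apply, Finset.sum_sub_distrib, Finset.sum_pi_single', Finset.mem_univ,
        if_true]
      lia

lemma exists_mem_totalDegreeGE (x : P) : ∃ B, x ∈ totalDegreeGE 𝒜 B := by
  induction x using homogeneous_induction 𝒜 with
  | hadd x y hx hy =>
    obtain ⟨B, hB⟩ := hx
    obtain ⟨B', hB'⟩ := hy
    refine ⟨min B B', Submodule.add_mem _ (fun c hc => hB c ?_) fun c hc => hB' c ?_⟩
    · exact hc.trans_le (min_le_left _ _)
    · exact hc.trans_le (min_le_right _ _)
  | h0 => exact ⟨0, Submodule.zero_mem _⟩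
  | h a x hx =>
    refine ⟨∑ l, a l, fun c hc => homogPart_of_mem_ne ?_ hx⟩
    rintro rfl
    exact lt_irrefl _ hc

/-- The degrees of a finitely generated multigraded module are bounded below. -/
lemma exists_degree_bound [Module.Finite (MvPolynomial (Fin n) K) P] :
    ∃ B : ℤ, ∀ c : Fin n → ℤ, ∑ l, c l < B → 𝒜 c = ⊥ := by
  obtain ⟨s, hs⟩ := Module.Finite.fg_top (R := MvPolynomial (Fin n) K) (M := P)
  choose B hB using exists_mem_totalDegreeGE 𝒜
  obtain ⟨B₀, hB₀⟩ := (s.image B).finite_toSet.bddBelow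
  refine ⟨B₀, fun c hc => (Submodule.eq_bot_iff _).2 fun x hx => ?_⟩
  have hle : (⊤ : Submodule (MvPolynomial (Fin n) K) P) ≤ totalDegreeGE 𝒜 B₀ := by
    rw [← hs, Submodule.span_le]
    exact fun y hy c hc => hB y c (hc.trans_le (hB₀ (Finset.mem_coe.2 (Finset.mem_image_of_mem _ hy))))
  rw [← homogPart_of_mem hx]
  exact hle (Submodule.mem_top (x := x)) c hc

end DegreeBound

/-! ### Cycles in the bottom row and their faces. -/

section BottomRow

variable {K : Type*} [Field K] {n : ℕ}
  {P : Type*} [AddCommGroup P] [Module K P] [Module (MvPolynomial (Fin n) K) P]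
  {𝒜 : (Fin n → ℤ) → Submodule K P} [IsMultigraded 𝒜]

/-- There are no nonzero boundaries in the lowest row of the Koszul complex. -/
lemma IsHomogeneous.eq_zero_of_diff_eq {d : ℤ} (hd : ∀ c : Fin n → ℤ, ∑ l, c l < d → 𝒜 c = ⊥)
    {i : ℕ} {a : Fin n → ℤ} (ha : ∑ l, a l = i + d) {z w : Finset (Fin n) → P}
    (hz : IsHomogeneous 𝒜 i a z) (hw : Koszul.diff K w = z) : z = 0 := by
  obtain ⟨w', hw', rfl⟩ := hz.exists_diff_eq hw
  rw [show w' = 0 from ?_, map_zero]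
  ext L
  by_cases hL : L.card = i + 1
  · have h := hw'.2 L
    -- The coefficient at `L` has total degree `(i + d) - (i + 1) = d - 1`.
    rw [hd _ ?_, Submodule.mem_bot] at h
    · exact h
    · simp only [Pi.sub_apply, Finset.sum_sub_distrib, sum_basisDeg, ha, hL]
      push_cast
      lia
  · exact hw'.1 L hL

lemma hasHomology_top_iff {d : ℤ} (hd : ∀ c : Fin n → ℤ, ∑ l, c l < d → 𝒜 c = ⊥)
    {i : ℕ} {a : Fin n → ℤ} (ha : ∑ l, a l = i + d) :
    HasHomology 𝒜 ⊤ i a ↔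
      ∃ z : Finset (Fin n) → P, IsHomogeneous 𝒜 i a z ∧ Koszul.diff K z = 0 ∧ z ≠ 0 := by
  constructor
  · rintro ⟨z, hz, -, hdz, h⟩
    refine ⟨z, hz, hdz, ?_⟩
    rintro rfl
    exact h ⟨0, fun _ => trivial, map_zero _⟩
  · rintro ⟨z, hz, hdz, h⟩
    exact ⟨z, hz, fun _ => trivial, hdz, fun ⟨w, _, hw⟩ => h (hz.eq_zero_of_diff_eq hd ha hw)⟩

lemma HasHomology.exists_ne_bot {i : ℕ} {a : Fin n → ℤ}
    {Z : Submodule (MvPolynomial (Fin n) K) P} (h : HasHomology 𝒜 Z i a) : ∃ c, 𝒜 c ≠ ⊥ := by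
  by_contra! hbot
  obtain ⟨z, hz, -, -, h⟩ := h
  refine h ⟨0, fun _ => Z.zero_mem, ?_⟩
  rw [map_zero]
  ext L
  have := hz.2 L
  rw [hbot, Submodule.mem_bot] at this
  exact this.symm

lemma contr_apply_erase {c : Finset (Fin n) → P} {j : Fin n} {L : Finset (Fin n)} (hj : j ∈ L)
    (hc : c L ≠ 0) : contr K j c (L.erase j) ≠ 0 := by
  rw [contr_apply, if_neg (by simp), Finset.insert_erase hj]
  intro h
  apply hc
  rw [← one_smul ℤ (c L), ← sign_mul_self j (L.erase j), mul_smul, h, smul_zero]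

/-- Iterated contraction of a cycle. -/
lemma IsHomogeneous.exists_cycle_of_subset {p i : ℕ} {a : Fin n → ℤ} {z : Finset (Fin n) → P}
    (hz : IsHomogeneous 𝒜 p a z) (hdz : Koszul.diff K z = 0) {J L : Finset (Fin n)} (hJL : J ⊆ L)
    (hL : z L ≠ 0) (hp : i + J.card = p) :
    ∃ z' : Finset (Fin n) → P, IsHomogeneous 𝒜 i (a - basisDeg J) z' ∧
      Koszul.diff K z' = 0 ∧ z' ≠ 0 := by
  induction J using Finset.induction_on generalizing p a z L with
  | empty =>
    obtain rfl : i = p := by simpa using hp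
    exact ⟨z, by simpa using hz, hdz, fun h => hL (by simp [h])⟩
  | insert j J hj ih =>
    rw [Finset.card_insert_of_notMem hj, ← add_assoc] at hp
    subst hp
    rw [basisDeg_insert hj, ← sub_sub]
    refine ih (hz.contr j) ?_ ?_ (contr_apply_erase (K := K) (hJL (Finset.mem_insert_self j J)) hL)
      rfl
    · have := contr_diff (K := K) j z
      rw [hdz, map_zero] at this
      exact neg_eq_zero.1 this.symm
    · intro l hl
      exact Finset.mem_erase.2 ⟨fun e => hj (e ▸ hl), hJL (Finset.mem_insert_of_mem hl)⟩

open Classical in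
/-- The sets with `s` elements that are contained in a set on which the chain does not vanish. -/
def supportFaces (z : Finset (Fin n) → P) (s : ℕ) : Finset (Finset (Fin n)) :=
  Finset.univ.filter fun J => J.card = s ∧ ∃ L, J ⊆ L ∧ z L ≠ 0

lemma mem_supportFaces {z : Finset (Fin n) → P} {s : ℕ} {J : Finset (Fin n)} :
    J ∈ supportFaces z s ↔ J.card = s ∧ ∃ L, J ⊆ L ∧ z L ≠ 0 := by
  simp [supportFaces]

-- Adjoining `j` is injective on the faces of the contraction, since none of them contains `j`, and
-- produces faces of `z` through `j`.
open Classical in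
lemma card_supportFaces_contr_le (z : Finset (Fin n) → P) (s : ℕ) (j : Fin n) :
    (supportFaces (contr K j z) s).card ≤ ((supportFaces z (s + 1)).filter (j ∈ ·)).card := by
  have key : ∀ J ∈ supportFaces (contr K j z) s, j ∉ J ∧ insert j J ∈ supportFaces z (s + 1) := by
    intro J hJ
    obtain ⟨hs, L, hL, hne⟩ := mem_supportFaces.1 hJ
    have hjL : j ∉ L := fun h => hne (by rw [contr_apply, if_pos h])
    rw [contr_apply, if_neg hjL] at hne
    have hjJ : j ∉ J := fun h => hjL (hL h)
    exact ⟨hjJ, mem_supportFaces.2 ⟨by rw [Finset.card_insert_of_notMem hjJ, hs], insert j L,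
      Finset.insert_subset_insert j hL, fun h => hne (by rw [h, smul_zero])⟩⟩
  refine Finset.card_le_card_of_injOn (insert j) (fun J hJ => ?_) fun J hJ J' hJ' h => ?_
  · exact Finset.mem_filter.2 ⟨(key J hJ).2, Finset.mem_insert_self j J⟩
  · rw [← Finset.erase_insert (key J hJ).1, h, Finset.erase_insert (key J' hJ').1]

/-- Suppose that the Koszul homology in every degree `i ≥ 1` with respect to fewer than `i + k`
variables vanishes. Then a nonzero cycle in the lowest row has at least as many faces as a simplex
on `p + k` vertices. -/
theorem choose_le_card_supportFaces {k : ℕ} {d : ℤ}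
    (hk : ∀ (i : ℕ) (D : Finset (Fin n)), i ≠ 0 → D.card < i + k →
      HomologyVanishes D (⊤ : Submodule (MvPolynomial (Fin n) K) P) i)
    (hd : ∀ c : Fin n → ℤ, ∑ l, c l < d → 𝒜 c = ⊥) {s p : ℕ} (hs : s ≤ p) {a : Fin n → ℤ}
    (ha : ∑ l, a l = p + d) {z : Finset (Fin n) → P} (hz : IsHomogeneous 𝒜 p a z)
    (hdz : Koszul.diff K z = 0) (hz0 : z ≠ 0) :
    (p + k).choose s ≤ (supportFaces z s).card := by
  classical
  induction s generalizing p a z with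
  | zero =>
    rw [Nat.choose_zero_right, Nat.one_le_iff_ne_zero, Finset.card_ne_zero]
    obtain ⟨L, hL⟩ := Function.ne_iff.1 hz0
    exact ⟨∅, mem_supportFaces.2 ⟨rfl, L, Finset.empty_subset L, hL⟩⟩
  | succ s ih =>
    obtain ⟨q, rfl⟩ : ∃ q, p = q + 1 := ⟨p - 1, by lia⟩
    -- The variables occurring in `z`, which is therefore supported on `D`.
    set D : Finset (Fin n) := Finset.univ.filter fun j => contr K j z ≠ 0 with hDdef
    have hD : q + 1 + k ≤ D.card := by
      by_contra! hlt
      obtain ⟨w, -, -, hw⟩ := hk (q + 1) D (Nat.succ_ne_zero q) hlt z (fun _ => trivial)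
        (fun L hL => by
          by_contra hne
          refine hL fun j hj => Finset.mem_filter.2 ⟨Finset.mem_univ j, fun h => ?_⟩
          exact contr_apply_erase (K := K) hj hne (by rw [h]; rfl)) hz.1 hdz
      exact hz0 (hz.eq_zero_of_diff_eq hd ha hw)
    have hrec : ∀ j ∈ D, (q + k).choose s ≤ (supportFaces (contr K j z) s).card := by
      intro j hj
      refine ih (by lia) ?_ (hz.contr j) ?_ (Finset.mem_filter.1 hj).2
      · simp only [Pi.sub_apply, Finset.sum_sub_distrib, Finset.sum_pi_single', Finset.mem_univ,
          if_true, ha]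
        push_cast
        ring
      · have := contr_diff (K := K) j z
        rw [hdz, map_zero] at this
        exact neg_eq_zero.1 this.symm
    -- Double count of pairs of a face with `s + 1` elements and a vertex in it.
    have hcount : (supportFaces z (s + 1)).card * (s + 1) =
        ∑ j : Fin n, ((supportFaces z (s + 1)).filter (j ∈ ·)).card := by
      simp only [Finset.card_filter]
      rw [Finset.sum_comm, ← smul_eq_mul, ← Finset.sum_const]
      refine Finset.sum_congr rfl fun J hJ => ?_
      rw [← (mem_supportFaces.1 hJ).1]
      simp
    refine Nat.le_of_mul_le_mul_right ?_ (Nat.succ_pos s)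
    calc (q + 1 + k).choose (s + 1) * (s + 1) = (q + k + 1) * (q + k).choose s := by
          rw [Nat.add_one_mul_choose_eq, add_right_comm]
      _ ≤ D.card * (q + k).choose s := Nat.mul_le_mul_right _ (by lia)
      _ = ∑ j ∈ D, (q + k).choose s := by rw [Finset.sum_const, smul_eq_mul]
      _ ≤ ∑ j ∈ D, ((supportFaces z (s + 1)).filter (j ∈ ·)).card :=
          Finset.sum_le_sum fun j hj => (hrec j hj).trans (card_supportFaces_contr_le z s j)
      _ ≤ ∑ j : Fin n, ((supportFaces z (s + 1)).filter (j ∈ ·)).card :=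
          Finset.sum_le_sum_of_subset (Finset.subset_univ D)
      _ = (supportFaces z (s + 1)).card * (s + 1) := hcount.symm

end BottomRow

end Koszul

/-! ### From nonzero Koszul classes to Betti numbers. -/

lemma Cardinal.sum_ne_zero_iff_exists {ι : Type*} (f : ι → Cardinal) :
    Cardinal.sum f ≠ 0 ↔ ∃ i, f i ≠ 0 := by
  rw [Cardinal.sum, Cardinal.mk_ne_zero_iff, nonempty_sigma]
  exact exists_congr fun i => by rw [← Cardinal.mk_ne_zero_iff, Cardinal.mk_out]

lemma Cardinal.card_le_sum_of_ne_zero {ι : Type*} (f : ι → Cardinal) (T : Finset ι)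
    (h : ∀ a ∈ T, f a ≠ 0) : (T.card : Cardinal) ≤ Cardinal.sum f := by
  have h' : ∀ a : T, Nonempty (f a).out := fun a =>
    Cardinal.mk_ne_zero_iff.1 (by rw [Cardinal.mk_out]; exact h a a.2)
  have hemb : Nonempty (T ↪ Σ a, (f a).out) :=
    ⟨⟨fun a => ⟨a, (h' a).some⟩, fun a b hab => Subtype.ext (congrArg Sigma.fst hab)⟩⟩
  have := Cardinal.lift_mk_le'.2 hemb
  rw [Cardinal.mk_coe_finset, Cardinal.lift_natCast] at this
  exact Cardinal.nat_le_lift_iff.1 this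

section Betti

open Koszul

variable {K : Type*} [Field K] {n : ℕ} {M : Type*} [AddCommGroup M] [Module K M]
  [Module (MvPolynomial (Fin n) K) M] (ℳ : (Fin n → ℤ) → Submodule K M) [IsMultigraded ℳ]

lemma multiBetti_ne_zero_iff (i : ℕ) (a : Fin n → ℤ) :
    multiBetti ℳ i a ≠ 0 ↔ HasHomology ℳ ⊤ i a := by
  rw [← (standardResolution ℳ).nontrivial_tor_iff_hasHomology, multiBetti, Ne, rank_zero_iff,
    not_subsingleton_iff_nontrivial]

lemma gradedBetti_ne_zero_iff (i : ℕ) (j : ℤ) :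
    gradedBetti ℳ i j ≠ 0 ↔ ∃ a : Fin n → ℤ, ∑ l, a l = j ∧ HasHomology ℳ ⊤ i a := by
  rw [gradedBetti, Cardinal.sum_ne_zero_iff_exists, Subtype.exists]
  simp only [multiBetti_ne_zero_iff, exists_prop]

lemma card_le_gradedBetti (i : ℕ) (j : ℤ) (T : Finset (Fin n → ℤ))
    (hT : ∀ a ∈ T, ∑ l, a l = j ∧ HasHomology ℳ ⊤ i a) :
    (T.card : Cardinal) ≤ gradedBetti ℳ i j := by
  rw [← Finset.card_attach, ← Finset.card_map
    ⟨fun a : T => (⟨a, (hT a a.2).1⟩ : {a : Fin n → ℤ // ∑ l, a l = j}),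
      fun _ _ h => Subtype.ext (Subtype.mk.inj h)⟩]
  refine Cardinal.card_le_sum_of_ne_zero _ _ fun b hb => ?_
  obtain ⟨a, -, rfl⟩ := Finset.mem_map.1 hb
  exact (multiBetti_ne_zero_iff ℳ i a).2 (hT a a.2).2

variable [IsScalarTower K (MvPolynomial (Fin n) K) M] [Module.Finite (MvPolynomial (Fin n) K) M]

/-- The linear strand starts in the lowest degree of the module. -/
lemma eq_bot_of_sum_lt_linDegree (hM : ∃ c, ℳ c ≠ ⊥) (c : Fin n → ℤ)
    (hc : ∑ l, c l < linDegree ℳ 0) : ℳ c = ⊥ := by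
  obtain ⟨B, hB⟩ := exists_degree_bound ℳ
  obtain ⟨d, ⟨c₀, hc₀, hne⟩, hmin⟩ := Int.exists_least_of_bdd
    (P := fun j => ∃ c : Fin n → ℤ, ∑ l, c l = j ∧ ℳ c ≠ ⊥)
    ⟨B, by
      rintro _ ⟨c, rfl, h⟩
      by_contra! hlt
      exact h (hB c hlt)⟩
    (by obtain ⟨c, h⟩ := hM; exact ⟨_, c, rfl, h⟩)
  have hd : ∀ c : Fin n → ℤ, ∑ l, c l < d → ℳ c = ⊥ := by
    intro c hc
    by_contra h
    exact absurd (hmin _ ⟨c, rfl, h⟩) (not_le.2 hc)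
  have hmem : gradedBetti ℳ 0 ((0 : ℕ) + d) ≠ 0 := by
    obtain ⟨y, hy, hy0⟩ := (Submodule.ne_bot_iff _).1 hne
    refine (gradedBetti_ne_zero_iff ℳ _ _).2 ⟨c₀, by simpa using hc₀,
      (hasHomology_top_iff hd (by simpa using hc₀)).2 ⟨Pi.single ∅ y, isHomogeneous_single ℳ hy,
        diff_single_empty y, ?_⟩⟩
    simpa using hy0
  have hleast : IsLeast ({j : ℤ | gradedBetti ℳ 0 ((0 : ℕ) + j) ≠ 0} ∪
      {r | IsRegularity ℳ r}) d := by
    refine ⟨Or.inl hmem, ?_⟩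
    rintro j (hj | hj)
    · obtain ⟨c, hc, hh⟩ := (gradedBetti_ne_zero_iff ℳ _ _).1 hj
      obtain ⟨y, hy, -, hne⟩ := (hasHomology_zero_iff ℳ).1 hh
      refine hmin j ⟨c, by simpa using hc, fun h => hne ?_⟩
      rw [h, Submodule.mem_bot] at hy
      rw [hy]
      exact Submodule.zero_mem _
    -- The regularity is an upper bound for `d`, so adjoining it does not lower the minimum.
    · exact hj.2 ⟨0, hmem⟩
  refine hd c ?_
  rwa [linDegree, hleast.csInf_eq] at hc

end Betti

end

theorem corollary4p3 {K : Type*} [Field K] {n : ℕ}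
    {M : Type*} [AddCommGroup M] [Module K M] [Module (MvPolynomial (Fin n) K) M]
    [IsScalarTower K (MvPolynomial (Fin n) K) M] [Module.Finite (MvPolynomial (Fin n) K) M]
    (ℳ : (Fin n → ℤ) → Submodule K M) [IsMultigraded ℳ]
    {N : Type*} [AddCommGroup N] [Module K N] [Module (MvPolynomial (Fin n) K) N]
    [IsScalarTower K (MvPolynomial (Fin n) K) N] [Module.Finite (MvPolynomial (Fin n) K) N]
    (𝒩 : (Fin n → ℤ) → Submodule K N) [IsMultigraded 𝒩]
    (F : GradedFreeResolution 𝒩) (hF : F.IsMinimal) (k : ℕ) (hM : F.IsSyzygy ℳ k)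
    (p : ℕ) (hp : linBetti ℳ p ≠ 0) (i : ℕ) (hi : i ≤ p) :
    ((p + k).choose (i + k) : Cardinal) ≤ linBetti ℳ i := by
  classical
  obtain ⟨a, ha, hh⟩ := (gradedBetti_ne_zero_iff ℳ p _).1 hp
  have hd := eq_bot_of_sum_lt_linDegree ℳ hh.exists_ne_bot
  obtain ⟨z, hz, hdz, hz0⟩ := (Koszul.hasHomology_top_iff hd ha).1 hh
  have hcard := Koszul.choose_le_card_supportFaces
    (fun i D hi hD => hM.homologyVanishes hi hD) hd (Nat.sub_le p i) ha hz hdz hz0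
  have hinj : Function.Injective fun J : Finset (Fin n) => a - Koszul.basisDeg J :=
    sub_right_injective.comp Koszul.basisDeg_injective
  -- The faces counted have `p - i` elements, the complementary index to `i + k` in `p + k`.
  rw [← Nat.choose_symm_of_eq_add (show p + k = (p - i) + (i + k) by lia)]
  refine (Nat.cast_le.2 hcard).trans ?_
  rw [← Finset.card_image_of_injective _ hinj]
  refine card_le_gradedBetti ℳ i _ _ fun b hb => ?_
  obtain ⟨J, hJ, rfl⟩ := Finset.mem_image.1 hb
  obtain ⟨hJc, L, hJL, hL⟩ := Koszul.mem_supportFaces.1 hJ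
  have hdeg : ∑ l, (a - Koszul.basisDeg J) l = i + linDegree ℳ 0 := by
    simp only [Pi.sub_apply, Finset.sum_sub_distrib, Koszul.sum_basisDeg, ha, hJc]
    push_cast [hi]
    ring
  exact ⟨hdeg, (Koszul.hasHomology_top_iff hd hdeg).2
    (hz.exists_cycle_of_subset hdz hJL hL (by lia))⟩
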